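/- Let $M$ be a compact oriented hyperbolic $3$-manifold with tubular boundary of finite tube radii: the interior of $M$ is locally isometric to $\mathbb H^3$, and near each boundary point there are positively oriented cylindrical coordinates $(r,\theta,\zeta)$, $r\ge R$, with metric $dr^2+\sinh^2 r\,d\theta^2+\cosh^2 r\,d\zeta^2$ and $\partial M=\{r=R\}$, where $R>0$ (the tube radius) is constant on each boundary component; so the boundary components are flat tori with principal curvatures $\coth R,\tanh R$. Let $E$ be the flat bundle of infinitesimal isometries of $M$, identified with $TM\otimes\mathbb C$ (real part: infinitesimal translation, imaginary part: infinitesimal rotation), with $d_E s(X)=\nabla_X s+i\,s\times X$ on sections, and let $\delta_E$ be the adjoint of $d_E$ for the Hermitian metric on $TM\otimes\mathbb C$. An $E$-valued $1$-form $\omega$ is harmonic if $d_E\omega=0$ and $\delta_E\omega=0$. Its divergence is the trace of its real part, viewed as an element of $\mathrm{Hom}(TM,TM)$. A $1$-form is in standard form near the boundary if near each boundary component it equals $a\,\omega_m+b\,\omega_l$ for constants $a,b\in\mathbb C$, where, in the orthonormal frame $\partial_r,\ \partial_\theta/\sinh r,\ \partial_\zeta/\cosh r$ and with $c=\cosh r$,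 $s=\sinh r$, $$\omega_m=\begin{pmatrix}-\frac1{c^2s^2}&0&0\\0&\frac1{s^2}&-\frac{i}{cs}\\0&-\frac{i}{cs}&-\frac1{c^2}\end{pmatrix},\qquad \omega_l=\begin{pmatrix}-\frac1{c^2}&0&0\\0&-1&-\frac{is}{c}\\0&-\frac{is}{c}&\frac{c^2+1}{c^2}\end{pmatrix}.$$ Let $\omega=\hat\omega+d_E s$ be a smooth harmonic $E$-valued $1$-form on $M$, where $\hat\omega$ is smooth and in standard form near the boundary and $s=u+i\,\tilde u$ is a smooth global section of $E$. Let $\tau,\tilde\tau$ be the $1$-forms dual to $u,\tilde u$, and assume $2\tilde\tau=\hat *\hat d\tau$ (that is, $2\tilde u=\operatorname{curl}u$) along $\partial M$. Write $\tau=h\,dr+\sigma$ and $\tilde\tau=\tilde h\,dr+\tilde\sigma$ along $\partial M$, with $\sigma,\tilde\sigma$ tangential and $dr$ dual to the inward unit normal $n$. Let $\hat d,\hat\delta,\hat *$ be the exterior derivative, codifferential and Hodge star of $M$, and $d,\delta,*$ those of $\partial M$, oriented by $n$. Let $S(X)=\nabla_X n$ be the shape operator, acting on $1$-forms by $(S\alpha)(X)=\alpha(SX)$,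 and put $d_S=Sd$, $\delta_S=\delta S$, $\triangle_S=\delta d+d_S\delta_S$. Suppose that for some constant $\varepsilon>0$, on $\partial M$, $$\hat\delta\tau-2\varepsilon(\delta_S\sigma-2h)=0,\qquad 2\tilde\sigma-*\bigl(2S\sigma+\varepsilon(\triangle_S\sigma-2d_Sh)\bigr)=0.$$ Then the divergence of $\omega$ is identically zero on $M$. Moreover, on $\partial M$, $$2h=\delta_S\sigma,\qquad 2\tilde\sigma=*(2S\sigma+\varepsilon\,\delta d\sigma).$$ -/

import Mathlib

open Set Matrix Bundle
open scoped Manifold ContDiff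

noncomputable section

namespace HarmonicDeformation

/-! ## Riemannian calculus in coordinates

A metric, a vector field, a `1`-form, ... on a coordinate domain `K ⊆ ℝⁿ` is given by its components,
which are functions on `ℝⁿ` of which only the values on the domain matter. In dimension `3` the
domain is a relatively open part of the closed half-space `{x₀ ≥ 0}`, in dimension `2`
(the boundary surface) it is an open part of `ℝ²`. -/

/-- Coordinate space. -/
abbrev Coord (n : ℕ) := EuclideanSpace ℝ (Fin n)

/-- The closed half-space `{x₀ ≥ 0}`. -/
def halfSpace : Set (Coord 3) := {x | 0 ≤ x 0}

/-- The partial derivative `∂ᵢ f` at `x` of a function on a domain that is relatively open in `K`. -/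
def pd {n : ℕ} (K : Set (Coord n)) (i : Fin n) (f : Coord n → ℝ) (x : Coord n) : ℝ :=
  fderivWithin ℝ f K x (EuclideanSpace.single i 1)

/-- The components of the differential of a function. -/
def grad {n : ℕ} (K : Set (Coord n)) (f : Coord n → ℝ) (x : Coord n) : Fin n → ℝ :=
  fun i => pd K i f x

/-- The codifferential of a `1`-form `α` for the metric `G`,
`δα = -(det G)^(-1/2) ∑ᵢ ∂ᵢ ((det G)^(1/2) αⁱ)` with `αⁱ = ∑ⱼ Gⁱʲ αⱼ`. -/
def codiff {n : ℕ} (K : Set (Coord n)) (G : Coord n → Matrix (Fin n) (Fin n) ℝ)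
    (α : Coord n → Fin n → ℝ) (x : Coord n) : ℝ :=
  -(√(G x).det)⁻¹ * ∑ i, pd K i (fun z => √(G z).det * ((G z)⁻¹ *ᵥ α z) i) x

/-! ### Dimension three -/

/-- The `1`-form dual to a vector field. -/
def lower (G : Coord 3 → Matrix (Fin 3) (Fin 3) ℝ) (U : Coord 3 → Fin 3 → ℝ) :
    Coord 3 → Fin 3 → ℝ :=
  fun x => G x *ᵥ U x

/-- The Christoffel symbol `Γᵏᵢⱼ` of the Levi-Civita connection. -/
def christoffel (G : Coord 3 → Matrix (Fin 3) (Fin 3) ℝ) (k i j : Fin 3) (x : Coord 3) : ℝ :=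
  (1 / 2) * ∑ l, (G x)⁻¹ k l * (pd halfSpace i (fun z => G z j l) x
    + pd halfSpace j (fun z => G z i l) x - pd halfSpace l (fun z => G z i j) x)

/-- The covariant derivative of a vector field: the matrix of `X ↦ ∇_X U`, whose entry `(k, i)` is
`(∇ᵢ U)ᵏ`. -/
def covDeriv (G : Coord 3 → Matrix (Fin 3) (Fin 3) ℝ) (U : Coord 3 → Fin 3 → ℝ) (x : Coord 3) :
    Matrix (Fin 3) (Fin 3) ℝ :=
  Matrix.of fun k i => pd halfSpace i (fun z => U z k) x + ∑ j, christoffel G k i j x * U x j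

/-- The covariant derivative of a vector valued `1`-form `W` (given as the matrix of an endomorphism
of the tangent bundle): the vector `(∇ᵢ W)(∂ⱼ)`. -/
def covDerivEnd (G : Coord 3 → Matrix (Fin 3) (Fin 3) ℝ) (W : Coord 3 → Matrix (Fin 3) (Fin 3) ℝ)
    (i j : Fin 3) (x : Coord 3) : Fin 3 → ℝ :=
  fun k => pd halfSpace i (fun z => W z k j) x
    + ∑ l, christoffel G k i l x * W x l j - ∑ l, christoffel G l i j x * W x k l

/-- The cross product of tangent vectors at `x`, for the metric `G` and the orientation of the
coordinates. -/
def cross (G : Coord 3 → Matrix (Fin 3) (Fin 3) ℝ) (x : Coord 3) (a b : Fin 3 → ℝ) : Fin 3 → ℝ :=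
  √(G x).det • ((G x)⁻¹ *ᵥ (a ⨯₃ b))

/-- The infinitesimal rotation `X ↦ a × X`. -/
def rot (G : Coord 3 → Matrix (Fin 3) (Fin 3) ℝ) (x : Coord 3) (a : Fin 3 → ℝ) :
    Matrix (Fin 3) (Fin 3) ℝ :=
  Matrix.of fun k i => cross G x a (Pi.single i 1) k

/-- The curl of a vector field; its dual `1`-form is `* d τ`, where `τ` is dual to the field. -/
def curl (G : Coord 3 → Matrix (Fin 3) (Fin 3) ℝ) (U : Coord 3 → Fin 3 → ℝ) (x : Coord 3) :
    Fin 3 → ℝ :=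
  let dτ : Fin 3 → Fin 3 → ℝ := fun i j =>
    pd halfSpace i (fun z => lower G U z j) x - pd halfSpace j (fun z => lower G U z i) x
  (√(G x).det)⁻¹ • ![dτ 1 2, dτ 2 0, dτ 0 1]

/-! ### The bundle `E = TM ⊗ ℂ` of infinitesimal isometries

The flat connection is `∇ᴱ_X s = ∇_X s + i s × X`, the real part being the infinitesimal
translation and the imaginary part the infinitesimal rotation. -/

/-- Real part of `d_E s` for `s = U + i U'`: `∇U - rot U'`. -/
def dERe (G : Coord 3 → Matrix (Fin 3) (Fin 3) ℝ) (U U' : Coord 3 → Fin 3 → ℝ) (x : Coord 3) :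
    Matrix (Fin 3) (Fin 3) ℝ :=
  covDeriv G U x - rot G x (U' x)

/-- Imaginary part of `d_E s` for `s = U + i U'`: `∇U' + rot U`. -/
def dEIm (G : Coord 3 → Matrix (Fin 3) (Fin 3) ℝ) (U U' : Coord 3 → Fin 3 → ℝ) (x : Coord 3) :
    Matrix (Fin 3) (Fin 3) ℝ :=
  covDeriv G U' x + rot G x (U x)

/-- Real part of `(d_E Ω)(∂ᵢ, ∂ⱼ)` for the `E`-valued `1`-form `Ω = W + i W'`, where
`(d_E Ω)(X, Y) = (∇_X Ω)(Y) - (∇_Y Ω)(X) + i Ω(Y) × X - i Ω(X) × Y`. -/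
def dEOneRe (G W W' : Coord 3 → Matrix (Fin 3) (Fin 3) ℝ) (i j : Fin 3) (x : Coord 3) :
    Fin 3 → ℝ :=
  covDerivEnd G W i j x - covDerivEnd G W j i x
    - cross G x ((W' x).col j) (Pi.single i 1) + cross G x ((W' x).col i) (Pi.single j 1)

/-- Imaginary part of `(d_E Ω)(∂ᵢ, ∂ⱼ)` for `Ω = W + i W'`. -/
def dEOneIm (G W W' : Coord 3 → Matrix (Fin 3) (Fin 3) ℝ) (i j : Fin 3) (x : Coord 3) :
    Fin 3 → ℝ :=
  covDerivEnd G W' i j x - covDerivEnd G W' j i x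
    + cross G x ((W x).col j) (Pi.single i 1) - cross G x ((W x).col i) (Pi.single j 1)

/-- Real part of `δ_E Ω` for `Ω = W + i W'`, where `δ_E`, the adjoint of `d_E` for the Hermitian
metric on `TM ⊗ ℂ`, is `δ_E Ω = ∑ (-(∇_e Ω)(e) + i Ω(e) × e)` over an orthonormal basis. -/
def deltaERe (G W W' : Coord 3 → Matrix (Fin 3) (Fin 3) ℝ) (x : Coord 3) : Fin 3 → ℝ :=
  ∑ i, ∑ j, (G x)⁻¹ i j •
    (-covDerivEnd G W i j x - cross G x ((W' x).col i) (Pi.single j 1))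

/-- Imaginary part of `δ_E Ω` for `Ω = W + i W'`. -/
def deltaEIm (G W W' : Coord 3 → Matrix (Fin 3) (Fin 3) ℝ) (x : Coord 3) : Fin 3 → ℝ :=
  ∑ i, ∑ j, (G x)⁻¹ i j •
    (-covDerivEnd G W' i j x + cross G x ((W x).col i) (Pi.single j 1))

/-! ### The boundary surface `{x₀ = 0}`

It is oriented by the inward normal, that is, by the coordinates `(x₁, x₂)` when `(x₀, x₁, x₂)`
are positively oriented. -/

/-- The inclusion of the boundary. -/
def bd (y : Coord 2) : Coord 3 := !₂[0, y 0, y 1]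

/-- The inward unit normal of the surfaces `x₀ = const`. -/
def normal (G : Coord 3 → Matrix (Fin 3) (Fin 3) ℝ) (x : Coord 3) : Fin 3 → ℝ :=
  fun i => (G x)⁻¹ i 0 / √((G x)⁻¹ 0 0)

/-- The metric of the boundary. -/
def bdMetric (G : Coord 3 → Matrix (Fin 3) (Fin 3) ℝ) (y : Coord 2) : Matrix (Fin 2) (Fin 2) ℝ :=
  (G (bd y)).submatrix Fin.succ Fin.succ

/-- The matrix of the shape operator `S(X) = ∇_X n` of the boundary. -/
def shape (G : Coord 3 → Matrix (Fin 3) (Fin 3) ℝ) (y : Coord 2) : Matrix (Fin 2) (Fin 2) ℝ :=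
  (covDeriv G (normal G) (bd y)).submatrix Fin.succ Fin.succ

/-- The normal component `h = τ(n)` on the boundary. -/
def normalPart (G : Coord 3 → Matrix (Fin 3) (Fin 3) ℝ) (τ : Coord 3 → Fin 3 → ℝ) (y : Coord 2) :
    ℝ :=
  τ (bd y) ⬝ᵥ normal G (bd y)

/-- The tangential part of a `1`-form on the boundary. -/
def tangPart (τ : Coord 3 → Fin 3 → ℝ) (y : Coord 2) : Fin 2 → ℝ :=
  fun a => τ (bd y) a.succ

/-- The shape operator on `1`-forms, `(Sα)(X) = α(SX)`. -/
def shapeForm (G : Coord 3 → Matrix (Fin 3) (Fin 3) ℝ) (α : Coord 2 → Fin 2 → ℝ) (y : Coord 2) :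
    Fin 2 → ℝ :=
  α y ᵥ* shape G y

/-- The Hodge star on `1`-forms of the boundary. -/
def hodgeStar (G : Coord 3 → Matrix (Fin 3) (Fin 3) ℝ) (α : Coord 2 → Fin 2 → ℝ) (y : Coord 2) :
    Fin 2 → ℝ :=
  let v := (bdMetric G y)⁻¹ *ᵥ α y
  √(bdMetric G y).det • ![-v 1, v 0]

/-- The codifferential `δ` on `1`-forms of the boundary. -/
def delta (G : Coord 3 → Matrix (Fin 3) (Fin 3) ℝ) (α : Coord 2 → Fin 2 → ℝ) : Coord 2 → ℝ :=
  codiff univ (bdMetric G) α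

/-- The function `* d α` on the boundary, for a `1`-form `α`. -/
def starD (G : Coord 3 → Matrix (Fin 3) (Fin 3) ℝ) (α : Coord 2 → Fin 2 → ℝ) (y : Coord 2) : ℝ :=
  (√(bdMetric G y).det)⁻¹ * (pd univ 0 (fun z => α z 1) y - pd univ 1 (fun z => α z 0) y)

/-- The operator `δ d = - * d * d` on `1`-forms of the boundary. -/
def deltaD (G : Coord 3 → Matrix (Fin 3) (Fin 3) ℝ) (α : Coord 2 → Fin 2 → ℝ) (y : Coord 2) :
    Fin 2 → ℝ :=
  -hodgeStar G (grad univ (starD G α)) y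

/-- `d_S = S d` on functions of the boundary. -/
def dS (G : Coord 3 → Matrix (Fin 3) (Fin 3) ℝ) (f : Coord 2 → ℝ) : Coord 2 → Fin 2 → ℝ :=
  shapeForm G (grad univ f)

/-- `δ_S = δ S` on `1`-forms of the boundary. -/
def deltaS (G : Coord 3 → Matrix (Fin 3) (Fin 3) ℝ) (α : Coord 2 → Fin 2 → ℝ) : Coord 2 → ℝ :=
  delta G (shapeForm G α)

/-- `Δ_S = δ d + d_S δ_S` on `1`-forms of the boundary. -/
def laplaceS (G : Coord 3 → Matrix (Fin 3) (Fin 3) ℝ) (α : Coord 2 → Fin 2 → ℝ) (y : Coord 2) :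
    Fin 2 → ℝ :=
  deltaD G α y + dS G (deltaS G α) y

/-! ### Model metrics and standard forms -/

/-- The hyperbolic metric of the upper half-space `{x₀ > 0}`. -/
def upperHalfMetric (x : Coord 3) : Matrix (Fin 3) (Fin 3) ℝ :=
  ((x 0) ^ 2)⁻¹ • (1 : Matrix (Fin 3) (Fin 3) ℝ)

/-- The hyperbolic metric `dr² + sinh² r dθ² + cosh² r dζ²` in cylindrical coordinates around a
geodesic, where `(x₀, x₁, x₂) = (r - R, θ, ζ)`. The half-space `{x₀ ≥ 0}` is the (universal cover
of the) exterior of the tube of radius `R`. -/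
def tubeMetric (R : ℝ) (x : Coord 3) : Matrix (Fin 3) (Fin 3) ℝ :=
  Matrix.diagonal ![1, Real.sinh (R + x 0) ^ 2, Real.cosh (R + x 0) ^ 2]

/-- The standard form `Ω_m` at distance `r` from the geodesic, as a matrix in the orthonormal frame
`(∂_r, ∂_θ / sinh r, ∂_ζ / cosh r)`. -/
def omegaM (r : ℝ) : Matrix (Fin 3) (Fin 3) ℂ :=
  let c : ℂ := Real.cosh r
  let s : ℂ := Real.sinh r
  !![-1 / (c ^ 2 * s ^ 2), 0, 0;
     0, 1 / s ^ 2, -Complex.I / (c * s);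
     0, -Complex.I / (c * s), -1 / c ^ 2]

/-- The standard form `Ω_l` at distance `r` from the geodesic, in the same frame. -/
def omegaL (r : ℝ) : Matrix (Fin 3) (Fin 3) ℂ :=
  let c : ℂ := Real.cosh r
  let s : ℂ := Real.sinh r
  !![-1 / c ^ 2, 0, 0;
     0, -1, -Complex.I * s / c;
     0, -Complex.I * s / c, (c ^ 2 + 1) / c ^ 2]

/-- The standard form `a Ω_m + b Ω_l` as a matrix in the coordinates of `tubeMetric R`. -/
def standardForm (R : ℝ) (a b : ℂ) (x : Coord 3) : Matrix (Fin 3) (Fin 3) ℂ :=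
  let len : Fin 3 → ℂ := ![1, Real.sinh (R + x 0), Real.cosh (R + x 0)]
  Matrix.of fun i j => (a * omegaM (R + x 0) i j + b * omegaL (R + x 0) i j) * len j / len i

/-! ## Three-manifolds with boundary -/

section Manifold

variable (M : Type*) [TopologicalSpace M] [ChartedSpace (EuclideanHalfSpace 3) M]

/-- Real vector fields (not necessarily continuous). -/
abbrev VField := ∀ p : M, TangentSpace (𝓡∂ 3) p

/-- Vector field valued `1`-forms, that is, fields of endomorphisms of the tangent spaces. -/
abbrev EndField := ∀ p : M, TangentSpace (𝓡∂ 3) p →L[ℝ] TangentSpace (𝓡∂ 3) p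

variable [IsManifold (𝓡∂ 3) ∞ M]

/-- Smooth Riemannian metrics. -/
abbrev RMetric :=
  ContMDiffRiemannianMetric (𝓡∂ 3) ∞ (Coord 3) (fun p : M => TangentSpace (𝓡∂ 3) p)

/-- A smooth section `s = re + i im` of `E = TM ⊗ ℂ`. -/
structure ESection where
  re : VField M
  im : VField M
  smooth_re : ContMDiff (𝓡∂ 3) ((𝓡∂ 3).prod 𝓘(ℝ, Coord 3)) ∞
    (fun p => TotalSpace.mk' (Coord 3) p (re p))
  smooth_im : ContMDiff (𝓡∂ 3) ((𝓡∂ 3).prod 𝓘(ℝ, Coord 3)) ∞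
    (fun p => TotalSpace.mk' (Coord 3) p (im p))

/-- A smooth `1`-form `Ω = re + i im` with values in `E = TM ⊗ ℂ`. -/
structure EOneForm where
  re : EndField M
  im : EndField M
  smooth_re : ContMDiff (𝓡∂ 3) ((𝓡∂ 3).prod 𝓘(ℝ, Coord 3 →L[ℝ] Coord 3)) ∞
    (fun p => TotalSpace.mk' (Coord 3 →L[ℝ] Coord 3) p (re p))
  smooth_im : ContMDiff (𝓡∂ 3) ((𝓡∂ 3).prod 𝓘(ℝ, Coord 3 →L[ℝ] Coord 3)) ∞
    (fun p => TotalSpace.mk' (Coord 3 →L[ℝ] Coord 3) p (im p))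

variable {M}

/-- Charts of `M`. -/
abbrev Chart (M : Type*) [TopologicalSpace M] [ChartedSpace (EuclideanHalfSpace 3) M] :=
  OpenPartialHomeomorph M (EuclideanHalfSpace 3)

/-- The image of a chart in coordinate space. -/
def chartImage (φ : Chart M) : Set (Coord 3) := (φ.extend (𝓡∂ 3)).target

/-- The point of `M` with coordinates `x`. -/
def pt (φ : Chart M) (x : Coord 3) : M := (φ.extend (𝓡∂ 3)).symm x

/-- The coordinate vector field `∂ᵢ` at the point with coordinates `x`. -/
def coordVec (φ : Chart M) (x : Coord 3) (i : Fin 3) : TangentSpace (𝓡∂ 3) (pt φ x) :=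
  mfderivWithin 𝓘(ℝ, Coord 3) (𝓡∂ 3) (φ.extend (𝓡∂ 3)).symm (range (𝓡∂ 3)) x
    (EuclideanSpace.single i (1 : ℝ) : Coord 3)

/-- The coordinates of a tangent vector at the point with coordinates `x`. -/
def vecCoord (φ : Chart M) (x : Coord 3) (v : TangentSpace (𝓡∂ 3) (pt φ x)) : Fin 3 → ℝ :=
  let w : Coord 3 := mfderiv (𝓡∂ 3) 𝓘(ℝ, Coord 3) (φ.extend (𝓡∂ 3)) (pt φ x) v
  fun i => w i

/-- The components of a vector field in a chart. -/
def fieldIn (φ : Chart M) (u : VField M) (x : Coord 3) : Fin 3 → ℝ :=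
  vecCoord φ x (u (pt φ x))

/-- The components of an endomorphism field in a chart. -/
def endIn (φ : Chart M) (η : EndField M) (x : Coord 3) : Matrix (Fin 3) (Fin 3) ℝ :=
  Matrix.of fun i j => vecCoord φ x (η (pt φ x) (coordVec φ x j)) i

/-- The components of the metric in a chart. -/
def metricIn (g : RMetric M) (φ : Chart M) (x : Coord 3) : Matrix (Fin 3) (Fin 3) ℝ :=
  Matrix.of fun i j => g.inner (pt φ x) (coordVec φ x i) (coordVec φ x j)

/-- `φ` is a smooth chart of `M` that is positively oriented for the orientation `o` of the tangent
spaces. -/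
def IsPositiveChart (o : ∀ p : M, Orientation ℝ (TangentSpace (𝓡∂ 3) p) (Fin 3)) (φ : Chart M) :
    Prop :=
  φ ∈ IsManifold.maximalAtlas (𝓡∂ 3) ∞ M ∧
  ∀ x ∈ chartImage φ, ∃ b : Module.Basis (Fin 3) ℝ (TangentSpace (𝓡∂ 3) (pt φ x)),
    (∀ i, b i = coordVec φ x i) ∧ b.orientation = o (pt φ x)

/-- The chart `φ` is an isometry onto a part of the exterior of the tube of radius `R`. -/
def IsTubeChart (g : RMetric M) (φ : Chart M) (R : ℝ) : Prop :=
  0 < R ∧ ∀ x ∈ chartImage φ, metricIn g φ x = tubeMetric R x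

/-- `M` with the metric `g` and the orientation `o` is an oriented hyperbolic `3`-manifold with
tubular boundary: an interior point has a positively oriented chart that is an isometry onto an open
subset of hyperbolic space (in the upper half-space model), and a boundary point has one that is an
isometry onto a relatively open subset of the exterior of a tube of some radius `R > 0` around a
geodesic. In particular `o` varies continuously, and the boundary is locally a flat surface with
principal curvatures `coth R` and `tanh R`. -/
structure IsHyperbolicTubular (g : RMetric M)
    (o : ∀ p : M, Orientation ℝ (TangentSpace (𝓡∂ 3) p) (Fin 3)) : Prop where
  interior : ∀ p ∈ (𝓡∂ 3).interior M, ∃ φ : Chart M, IsPositiveChart o φ ∧ p ∈ φ.source ∧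
    ∀ x ∈ chartImage φ, 0 < x 0 ∧ metricIn g φ x = upperHalfMetric x
  boundary : ∀ p ∈ (𝓡∂ 3).boundary M, ∃ (φ : Chart M) (R : ℝ),
    IsPositiveChart o φ ∧ p ∈ φ.source ∧ IsTubeChart g φ R

/-- `Ω` is harmonic: `d_E Ω = 0` and `δ_E Ω = 0`. -/
def IsHarmonic (g : RMetric M) (o : ∀ p : M, Orientation ℝ (TangentSpace (𝓡∂ 3) p) (Fin 3))
    (Ω : EOneForm M) : Prop :=
  ∀ φ : Chart M, IsPositiveChart o φ → ∀ x ∈ chartImage φ,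
    (∀ i j, dEOneRe (metricIn g φ) (endIn φ Ω.re) (endIn φ Ω.im) i j x = 0 ∧
      dEOneIm (metricIn g φ) (endIn φ Ω.re) (endIn φ Ω.im) i j x = 0) ∧
    deltaERe (metricIn g φ) (endIn φ Ω.re) (endIn φ Ω.im) x = 0 ∧
    deltaEIm (metricIn g φ) (endIn φ Ω.re) (endIn φ Ω.im) x = 0

/-- `Ω = Ω' + d_E s`. -/
def EqAddCoboundary (g : RMetric M) (o : ∀ p : M, Orientation ℝ (TangentSpace (𝓡∂ 3) p) (Fin 3))
    (Ω Ω' : EOneForm M) (s : ESection M) : Prop :=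
  ∀ φ : Chart M, IsPositiveChart o φ → ∀ x ∈ chartImage φ,
    endIn φ Ω.re x = endIn φ Ω'.re x
      + dERe (metricIn g φ) (fieldIn φ s.re) (fieldIn φ s.im) x ∧
    endIn φ Ω.im x = endIn φ Ω'.im x
      + dEIm (metricIn g φ) (fieldIn φ s.re) (fieldIn φ s.im) x

/-- `Ω` is in standard form near the boundary: near each boundary point it is a complex linear
combination of `Ω_m` and `Ω_l` in cylindrical coordinates. (The coefficients are then
constant on each boundary component.) -/
def IsStandardNearBoundary (g : RMetric M)
    (o : ∀ p : M, Orientation ℝ (TangentSpace (𝓡∂ 3) p) (Fin 3)) (Ω : EOneForm M) : Prop :=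
  ∀ p ∈ (𝓡∂ 3).boundary M, ∃ (φ : Chart M) (R : ℝ) (a b : ℂ),
    IsPositiveChart o φ ∧ p ∈ φ.source ∧ IsTubeChart g φ R ∧
    ∀ x ∈ chartImage φ, endIn φ Ω.re x = (standardForm R a b x).map Complex.re ∧
      endIn φ Ω.im x = (standardForm R a b x).map Complex.im

/-- The components in a chart of the `1`-form dual to a vector field. -/
def dualIn (g : RMetric M) (φ : Chart M) (u : VField M) : Coord 3 → Fin 3 → ℝ :=
  lower (metricIn g φ) (fieldIn φ u)

/-- `2 u' = curl u` at the points of the boundary. -/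
def IsHalfCurlOnBoundary (g : RMetric M)
    (o : ∀ p : M, Orientation ℝ (TangentSpace (𝓡∂ 3) p) (Fin 3)) (u u' : VField M) : Prop :=
  ∀ φ : Chart M, IsPositiveChart o φ → ∀ y : Coord 2, bd y ∈ chartImage φ →
    (2 : ℝ) • fieldIn φ u' (bd y) = curl (metricIn g φ) (fieldIn φ u) (bd y)

/-- The first boundary condition `δ̂ τ - 2 ε (δ_S σ - 2 h) = 0`, where `τ` is dual to `u`, with
normal part `h` and tangential part `σ`, and `δ̂` is the codifferential of `M`. -/
def BoundaryCondition₁ (g : RMetric M)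
    (o : ∀ p : M, Orientation ℝ (TangentSpace (𝓡∂ 3) p) (Fin 3)) (ε : ℝ) (u : VField M) : Prop :=
  ∀ φ : Chart M, IsPositiveChart o φ → ∀ y : Coord 2, bd y ∈ chartImage φ →
    let G := metricIn g φ
    let τ := dualIn g φ u
    let σ := tangPart τ
    let h := normalPart G τ
    codiff halfSpace G τ (bd y) - 2 * ε * (deltaS G σ y - 2 * h y) = 0

/-- The second boundary condition `2 σ' - * (2 S σ + ε (Δ_S σ - 2 d_S h)) = 0`, where `τ` is dual to
`u`, with normal part `h` and tangential part `σ`, and `σ'` is the tangential part of the dual of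
`u'`. -/
def BoundaryCondition₂ (g : RMetric M)
    (o : ∀ p : M, Orientation ℝ (TangentSpace (𝓡∂ 3) p) (Fin 3)) (ε : ℝ) (u u' : VField M) : Prop :=
  ∀ φ : Chart M, IsPositiveChart o φ → ∀ y : Coord 2, bd y ∈ chartImage φ →
    let G := metricIn g φ
    let τ := dualIn g φ u
    let σ := tangPart τ
    let h := normalPart G τ
    let σ' := tangPart (dualIn g φ u')
    (2 : ℝ) • σ' y - hodgeStar G (fun z => (2 : ℝ) • shapeForm G σ z
      + ε • (laplaceS G σ z - (2 : ℝ) • dS G h z)) y = 0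

/-- The divergence of `Ω`: the trace of its real part. -/
def divergence (Ω : EOneForm M) (p : M) : ℝ :=
  LinearMap.trace ℝ (TangentSpace (𝓡∂ 3) p) (Ω.re p).toLinearMap

end Manifold

end HarmonicDeformation

end

/-!
The divergence `f = tr Re Ω` is a smooth function on the compact manifold `M`, and it is shown to
vanish by the maximum principle.

*Interior.* Contracting `d_E Ω = 0` and `δ_E Ω = 0` gives `df = -curl A - 2 A'`, where `A` and `A'`
are the `1`-forms dual to the antisymmetric parts of the real and the imaginary part of `Ω`
(`IsWarpedAt.grad_trace`), while the alternating part of `d_E Ω = 0` gives `div A' = -2 f`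
(`IsWarpedAt.div_skew`). Hence `div grad f = 4 f`, which excludes a positive interior maximum of `f`
and of `-f` (`laplace_trace`, `mul_divergence_nonpos_of_isLocalMax`). Both model metrics are diagonal
with coefficients that depend on the first coordinate only, and everything is computed for such
metrics.

*Boundary.* Standard forms are symmetric and traceless, so near the boundary `A` and `A'` come from
`d_E s` alone, `f = -δ̂ τ`, and `A` vanishes along `∂M` because `2 u' = curl u` there. The normal
component of `df = -curl A - 2 A'` therefore reads `∂ₙ f = 2 * d σ' + 4 h`. By the second boundary
condition, with `F = δ_S σ - 2 h`, one has `2 * d σ' = -2 δ_S σ - ε δ (d_S F)`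
(`IsFlatAt.curl_of_condition`; the terms `δ δ d σ` vanish), so `∂ₙ f = -2 F - ε δ (S d F)`. The first
boundary condition says `f = -2 ε F`, and so `∂ₙ f = f / ε + (1 / 2) δ (S d f)`
(`normal_deriv_trace`). At a positive boundary maximum of `f` the left-hand side is `≤ 0`, `n` being
the inward normal, while the right-hand side is positive since the boundary metric is flat and `S` is
constant and positive definite (`mul_divergence_nonpos_of_isLocalMaxOn`). The same holds for `-f`.

Once `f = 0`, the first boundary condition gives `F = 0`, which is the first of the two boundary
identities, and the second boundary condition then reduces to the other one.
-/

open scoped Topology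

namespace HarmonicDeformation

/-! ### Charts -/

section Charts

variable {M : Type*} [TopologicalSpace M] [ChartedSpace (EuclideanHalfSpace 3) M]

lemma range_model_eq_halfSpace : range (𝓡∂ 3) = halfSpace :=
  range_modelWithCornersEuclideanHalfSpace 3

lemma pt_mem_source (φ : Chart M) {x : Coord 3} (hx : x ∈ chartImage φ) : pt φ x ∈ φ.source := by
  have := (φ.extend (𝓡∂ 3)).map_target hx
  rwa [φ.extend_source] at this

lemma extend_pt (φ : Chart M) {x : Coord 3} (hx : x ∈ chartImage φ) :
    φ.extend (𝓡∂ 3) (pt φ x) = x := (φ.extend (𝓡∂ 3)).right_inv hx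

lemma pt_extend (φ : Chart M) {p : M} (hp : p ∈ φ.source) :
    pt φ (φ.extend (𝓡∂ 3) p) = p := φ.extend_left_inv hp

lemma extend_mem_chartImage (φ : Chart M) {p : M} (hp : p ∈ φ.source) :
    φ.extend (𝓡∂ 3) p ∈ chartImage φ :=
  (φ.extend (𝓡∂ 3)).map_source (by rwa [φ.extend_source])

lemma chartImage_subset (φ : Chart M) : chartImage φ ⊆ halfSpace := by
  rw [← range_model_eq_halfSpace]
  exact φ.extend_target_subset_range

lemma chartImage_eventuallyEq (φ : Chart M) {x : Coord 3} (hx : x ∈ chartImage φ) :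
    chartImage φ =ᶠ[𝓝 x] halfSpace := by
  have := φ.extend_target_eventuallyEq (I := 𝓡∂ 3) (pt_mem_source φ hx)
  rwa [extend_pt φ hx, range_model_eq_halfSpace] at this

lemma chartImage_mem_nhdsWithin (φ : Chart M) {x : Coord 3} (hx : x ∈ chartImage φ) :
    chartImage φ ∈ 𝓝[halfSpace] x := by
  rw [← nhdsWithin_eq_iff_eventuallyEq.2 (chartImage_eventuallyEq φ hx)]
  exact self_mem_nhdsWithin

lemma uniqueDiffOn_halfSpace : UniqueDiffOn ℝ halfSpace := by
  rw [← range_model_eq_halfSpace]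
  exact (𝓡∂ 3).uniqueDiffOn

lemma uniqueDiffOn_chartImage (φ : Chart M) : UniqueDiffOn ℝ (chartImage φ) := fun x hx =>
  (uniqueDiffWithinAt_congr (nhdsWithin_eq_iff_eventuallyEq.2 (chartImage_eventuallyEq φ hx))).2
    (uniqueDiffOn_halfSpace x (chartImage_subset φ hx))

lemma contMDiffOn_pt {φ : Chart M} (hφ : φ ∈ IsManifold.maximalAtlas (𝓡∂ 3) ∞ M) :
    ContMDiffOn 𝓘(ℝ, Coord 3) (𝓡∂ 3) ∞ (pt φ) (chartImage φ) := by
  rw [chartImage, φ.extend_target']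
  exact contMDiffOn_extend_symm hφ

lemma mfderivWithin_pt {φ : Chart M} {x : Coord 3} (hx : x ∈ chartImage φ) :
    mfderivWithin 𝓘(ℝ, Coord 3) (𝓡∂ 3) (φ.extend (𝓡∂ 3)).symm (range (𝓡∂ 3)) x =
      mfderivWithin 𝓘(ℝ, Coord 3) (𝓡∂ 3) (pt φ) (chartImage φ) x := by
  rw [range_model_eq_halfSpace]
  exact (mfderivWithin_congr_set (chartImage_eventuallyEq φ hx)).symm

/-- Interior points are seen as interior points in every chart of the maximal atlas: otherwise the
coordinate change from the preferred chart would not be a local diffeomorphism. -/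
lemma extend_mem_interior_range {E H N : Type*} [NormedAddCommGroup E] [NormedSpace ℝ E]
    [TopologicalSpace H] {I : ModelWithCorners ℝ E H} [TopologicalSpace N] [ChartedSpace H N]
    {n : WithTop ℕ∞} [IsManifold I n N] (hn : n ≠ 0) {e : OpenPartialHomeomorph N H}
    (he : e ∈ IsManifold.maximalAtlas I n N) {p : N} (hp : p ∈ e.source)
    (hint : I.IsInteriorPoint p) : e.extend I p ∈ interior (range I) := by
  set e₀ := chartAt H p
  have hp₀ : p ∈ e₀.source := mem_chart_source _ p
  have he₀ : e₀ ∈ IsManifold.maximalAtlas I n N := IsManifold.chart_mem_maximalAtlas p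
  have hx : e₀.extend I p ∈ interior (e₀.extend I).target :=
    ModelWithCorners.isInteriorPoint_iff.1 hint
  let T := I.extendCoordChange e₀ e
  have hT : ContDiffOn ℝ n T T.source := I.contDiffOn_extendCoordChange he₀ he
  have hTx : T.source ∈ 𝓝 (e₀.extend I p) := by
    simp_rw [T, ModelWithCorners.extendCoordChange, PartialEquiv.trans_source,
      PartialEquiv.symm_source, Filter.inter_mem_iff, mem_interior_iff_mem_nhds.1 hx, true_and,
      e.extend_source]
    exact e₀.extend_preimage_mem_nhds hp₀ <| e.open_source.mem_nhds hp
  have hsurj := (I.isInvertible_fderivWithin_extendCoordChange hn he₀ he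
    (x := e₀.extend I p) (by simp [hp₀, hp])).surjective
  rw [fderivWithin_of_mem_nhds hTx] at hsurj
  rw [show e.extend I p = T (e₀.extend I p) by simp [T, hp₀]]
  exact ((hT.differentiableOn hn).differentiableAt hTx).mem_interior_convex_of_surjective_fderiv
    hTx I.convex_range I.isClosed_range I.nonempty_interior
    (T.mapsTo.mono_right <| by simp [T, inter_assoc]) hsurj

lemma pt_bd_mem_boundary [IsManifold (𝓡∂ 3) ∞ M] {φ : Chart M}
    (hφ : φ ∈ IsManifold.maximalAtlas (𝓡∂ 3) ∞ M) {y : Coord 2} (hy : bd y ∈ chartImage φ) :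
    pt φ (bd y) ∈ (𝓡∂ 3).boundary M := by
  rw [← (𝓡∂ 3).compl_interior]
  intro hint
  have h := extend_mem_interior_range (by simp) hφ (pt_mem_source φ hy) hint
  rw [extend_pt φ hy, interior_range_modelWithCornersEuclideanHalfSpace] at h
  simp [bd] at h

lemma _root_.ContDiffOn.differentiableWithinAt_halfSpace {f : Coord 3 → ℝ} {x : Coord 3}
    {φ : Chart M} (hf : ContDiffOn ℝ ∞ f (chartImage φ)) (hx : x ∈ chartImage φ) :
    DifferentiableWithinAt ℝ f halfSpace x :=
  ((hf x hx).differentiableWithinAt (by simp)).mono_of_mem_nhdsWithin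
    (chartImage_mem_nhdsWithin φ hx)

lemma vecCoord_coordVec {φ : Chart M} (hφ : φ ∈ IsManifold.maximalAtlas (𝓡∂ 3) ∞ M)
    {x : Coord 3} (hx : x ∈ chartImage φ) (i : Fin 3) :
    vecCoord φ x (coordVec φ x i) = Pi.single i 1 := by
  have h1 : MDifferentiableAt (𝓡∂ 3) 𝓘(ℝ, Coord 3) (φ.extend (𝓡∂ 3)) (pt φ x) :=
    (φ.contMDiffAt_extend hφ (pt_mem_source φ hx)).mdifferentiableAt (by simp)
  have h2 : MDifferentiableWithinAt 𝓘(ℝ, Coord 3) (𝓡∂ 3) (pt φ) (chartImage φ) x :=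
    ((contMDiffOn_pt hφ) x hx).mdifferentiableWithinAt (by simp)
  have hu := (uniqueDiffOn_chartImage φ x hx).uniqueMDiffWithinAt
  have h3 := mfderiv_comp_mfderivWithin x h1 h2 hu
  have h4 := (mfderivWithin_congr (I := 𝓘(ℝ, Coord 3)) (I' := 𝓘(ℝ, Coord 3)) (f := id)
    (f₁ := φ.extend (𝓡∂ 3) ∘ pt φ) (fun z hz => extend_pt φ hz) (extend_pt φ hx)).trans
    (mfderivWithin_id hu)
  rw [h4] at h3
  have h5 : mfderiv (𝓡∂ 3) 𝓘(ℝ, Coord 3) (φ.extend (𝓡∂ 3)) (pt φ x) (coordVec φ x i) =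
      (EuclideanSpace.single i (1 : ℝ) : Coord 3) := by
    rw [coordVec, mfderivWithin_pt hx]
    exact (DFunLike.congr_fun h3 (EuclideanSpace.single i (1 : ℝ) : Coord 3)).symm
  ext k
  simp only [vecCoord]
  rw [h5]
  simp [Pi.single_apply]

/-- The coordinate vectors as a basis of the tangent space. -/
lemma exists_basis_coordVec {o : ∀ p : M, Orientation ℝ (TangentSpace (𝓡∂ 3) p) (Fin 3)}
    {φ : Chart M} (hφ : IsPositiveChart o φ) {x : Coord 3} (hx : x ∈ chartImage φ) :
    ∃ b : Module.Basis (Fin 3) ℝ (TangentSpace (𝓡∂ 3) (pt φ x)),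
      (∀ i, b i = coordVec φ x i) ∧ ∀ v i, b.repr v i = vecCoord φ x v i := by
  obtain ⟨b, hb, -⟩ := hφ.2 x hx
  refine ⟨b, hb, fun v i => ?_⟩
  let L : TangentSpace (𝓡∂ 3) (pt φ x) →ₗ[ℝ] ℝ :=
    { toFun := fun v => vecCoord φ x v i
      map_add' := fun v w => by
        simp only [vecCoord]
        rw [map_add]; rfl
      map_smul' := fun c v => by
        simp only [vecCoord]
        rw [map_smul]; rfl }
  have : b.coord i = L := by
    refine b.ext fun j => ?_
    rw [Module.Basis.coord_apply, b.repr_self]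
    change _ = vecCoord φ x (b j) i
    rw [hb, vecCoord_coordVec hφ.1 hx, Finsupp.single_eq_pi_single]
  exact DFunLike.congr_fun this v

lemma contMDiffOn_const_field {E : Type*} [NormedAddCommGroup E] [NormedSpace ℝ E] (v : E)
    (s : Set E) :
    ContMDiffOn 𝓘(ℝ, E) 𝓘(ℝ, E).tangent ∞
      (fun x : E => (⟨x, v⟩ : TangentBundle 𝓘(ℝ, E) E)) s := by
  have : ContDiffOn ℝ ∞ (fun _ : E => v) s := contDiffOn_const
  exact contMDiffOn_vectorSpace_iff_contDiffOn.2 this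

variable [IsManifold (𝓡∂ 3) ∞ M]

lemma contMDiffOn_coordVec {φ : Chart M} (hφ : φ ∈ IsManifold.maximalAtlas (𝓡∂ 3) ∞ M)
    (i : Fin 3) :
    ContMDiffOn 𝓘(ℝ, Coord 3) ((𝓡∂ 3).prod 𝓘(ℝ, Coord 3)) ∞
      (fun x => TotalSpace.mk' (Coord 3) (E := fun p : M => TangentSpace (𝓡∂ 3) p)
        (pt φ x) (coordVec φ x i)) (chartImage φ) := by
  have h1 := (contMDiffOn_pt hφ).contMDiffOn_tangentMapWithin (m := ∞) (by simp)
    (uniqueDiffOn_chartImage φ).uniqueMDiffOn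
  have h2 := contMDiffOn_const_field (EuclideanSpace.single i (1 : ℝ) : Coord 3) (chartImage φ)
  refine (h1.comp h2 fun x hx => hx).congr fun x hx => ?_
  simp only [Function.comp, tangentMapWithin, coordVec]
  rw [mfderivWithin_pt hx]
  rfl

lemma contDiffOn_vecCoord {φ : Chart M} (hφ : φ ∈ IsManifold.maximalAtlas (𝓡∂ 3) ∞ M)
    {v : ∀ x : Coord 3, TangentSpace (𝓡∂ 3) (pt φ x)}
    (hv : ContMDiffOn 𝓘(ℝ, Coord 3) ((𝓡∂ 3).prod 𝓘(ℝ, Coord 3)) ∞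
      (fun x => TotalSpace.mk' (Coord 3) (E := fun p : M => TangentSpace (𝓡∂ 3) p)
        (pt φ x) (v x)) (chartImage φ)) (i : Fin 3) :
    ContDiffOn ℝ ∞ (fun x => vecCoord φ x (v x) i) (chartImage φ) := by
  have h1 := (φ.contMDiffOn_extend hφ).contMDiffOn_tangentMapWithin (m := ∞) (by simp)
    φ.open_source.uniqueMDiffOn
  have h2 := h1.comp hv fun x hx => pt_mem_source φ hx
  have h3 := (contMDiff_snd_tangentBundle_modelSpace (n := ∞) (Coord 3)
    𝓘(ℝ, Coord 3)).comp_contMDiffOn h2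
  refine (contDiffOn_euclidean.1 h3.contDiffOn i).congr fun x hx => ?_
  simp only [Function.comp, tangentMapWithin]
  rw [mfderivWithin_of_isOpen φ.open_source (pt_mem_source φ hx)]
  rfl

lemma contDiffOn_fieldIn {φ : Chart M} (hφ : φ ∈ IsManifold.maximalAtlas (𝓡∂ 3) ∞ M)
    {u : VField M} (hu : ContMDiff (𝓡∂ 3) ((𝓡∂ 3).prod 𝓘(ℝ, Coord 3)) ∞
      (fun p => TotalSpace.mk' (Coord 3) p (u p))) (i : Fin 3) :
    ContDiffOn ℝ ∞ (fun x => fieldIn φ u x i) (chartImage φ) :=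
  contDiffOn_vecCoord hφ (v := fun x => u (pt φ x)) (hu.comp_contMDiffOn (contMDiffOn_pt hφ)) i

lemma contDiffOn_endIn {φ : Chart M} (hφ : φ ∈ IsManifold.maximalAtlas (𝓡∂ 3) ∞ M)
    {η : EndField M} (hη : ContMDiff (𝓡∂ 3) ((𝓡∂ 3).prod 𝓘(ℝ, Coord 3 →L[ℝ] Coord 3)) ∞
      (fun p => TotalSpace.mk' (Coord 3 →L[ℝ] Coord 3) p (η p))) (i j : Fin 3) :
    ContDiffOn ℝ ∞ (fun x => endIn φ η x i j) (chartImage φ) := by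
  have h1 := hη.comp_contMDiffOn (contMDiffOn_pt hφ)
  have h2 := ContMDiffOn.clm_bundle_apply (F₁ := Coord 3) (F₂ := Coord 3)
    (E₁ := fun p : M => TangentSpace (𝓡∂ 3) p) (E₂ := fun p : M => TangentSpace (𝓡∂ 3) p)
    (b := pt φ) (ϕ := fun x => η (pt φ x)) (v := fun x => coordVec φ x j)
    h1 (contMDiffOn_coordVec hφ j)
  exact contDiffOn_vecCoord hφ h2 i

lemma contDiffOn_metricIn (g : RMetric M) {φ : Chart M}
    (hφ : φ ∈ IsManifold.maximalAtlas (𝓡∂ 3) ∞ M) (i j : Fin 3) :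
    ContDiffOn ℝ ∞ (fun x => metricIn g φ x i j) (chartImage φ) := by
  have h1 := g.contMDiff.comp_contMDiffOn (contMDiffOn_pt hφ)
  have h2 := ContMDiffOn.clm_bundle_apply₂ (F₁ := Coord 3) (F₂ := Coord 3) (F₃ := ℝ)
    (E₁ := fun p : M => TangentSpace (𝓡∂ 3) p) (E₂ := fun p : M => TangentSpace (𝓡∂ 3) p)
    (E₃ := Bundle.Trivial M ℝ)
    (b := pt φ) (ψ := fun x => g.inner (pt φ x)) (v := fun x => coordVec φ x i)
    (w := fun x => coordVec φ x j)
    h1 (contMDiffOn_coordVec hφ i) (contMDiffOn_coordVec hφ j)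
  intro x hx
  have h3 := h2 x hx
  rw [contMDiffWithinAt_totalSpace] at h3
  exact h3.2.contDiffWithinAt

lemma divergence_pt {o : ∀ p : M, Orientation ℝ (TangentSpace (𝓡∂ 3) p) (Fin 3)}
    {φ : Chart M} (hφ : IsPositiveChart o φ) {x : Coord 3} (hx : x ∈ chartImage φ)
    (Ω : EOneForm M) : divergence Ω (pt φ x) = (endIn φ Ω.re x).trace := by
  obtain ⟨b, hb, hr⟩ := exists_basis_coordVec hφ hx
  rw [divergence, LinearMap.trace_eq_matrix_trace ℝ b]
  congr 1
  ext i j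
  rw [LinearMap.toMatrix_apply, hr, hb]
  rfl

lemma metricIn_transpose (g : RMetric M) (φ : Chart M) (x : Coord 3) :
    (metricIn g φ x)ᵀ = metricIn g φ x := by
  ext i j
  exact g.symm _ _ _

lemma metricIn_det_pos (g : RMetric M)
    {o : ∀ p : M, Orientation ℝ (TangentSpace (𝓡∂ 3) p) (Fin 3)}
    {φ : Chart M} (hφ : IsPositiveChart o φ) {x : Coord 3} (hx : x ∈ chartImage φ) :
    0 < (metricIn g φ x).det := by
  obtain ⟨b, hb, -⟩ := exists_basis_coordVec hφ hx
  refine Matrix.PosDef.det_pos (Matrix.PosDef.of_dotProduct_mulVec_pos ?_ fun v hv => ?_)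
  · exact metricIn_transpose g φ x
  · have hne : ∑ i, v i • b i ≠ 0 := by
      intro h0
      exact hv (funext (Fintype.linearIndependent_iff.1 b.linearIndependent v h0))
    have := g.pos (pt φ x) _ hne
    have heq : star v ⬝ᵥ (metricIn g φ x *ᵥ v) =
        g.inner (pt φ x) (∑ i, v i • b i) (∑ i, v i • b i) := by
      simp only [map_sum, map_smul, _root_.sum_apply, _root_.smul_apply,
        dotProduct, mulVec, star_trivial, hb, Finset.mul_sum, smul_eq_mul]
      rw [Finset.sum_comm]
      refine Finset.sum_congr rfl fun i _ => Finset.sum_congr rfl fun j _ => ?_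
      simp only [metricIn, Matrix.of_apply]
      rw [g.symm]
      ring
    rw [heq]
    exact this

end Charts

/-! ### Partial derivatives -/

/-- `f` is differentiable at `x` within `K`, with `i`-th partial derivative `f'`. -/
def HasPd {n : ℕ} (K : Set (Coord n)) (i : Fin n) (f : Coord n → ℝ) (f' : ℝ) (x : Coord n) :
    Prop :=
  ∃ L : Coord n →L[ℝ] ℝ, HasFDerivWithinAt f L K x ∧ L (EuclideanSpace.single i 1) = f'

section Pd

variable {n : ℕ} {K : Set (Coord n)} {i : Fin n} {f g : Coord n → ℝ} {f' g' : ℝ} {x : Coord n}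

lemma HasPd.pd_eq (hf : HasPd K i f f' x) (hK : UniqueDiffWithinAt ℝ K x) : pd K i f x = f' := by
  obtain ⟨L, hL, rfl⟩ := hf
  rw [pd, hL.fderivWithin hK]

lemma _root_.DifferentiableWithinAt.hasPd (hf : DifferentiableWithinAt ℝ f K x) (i : Fin n) :
    HasPd K i f (pd K i f x) x := ⟨_, hf.hasFDerivWithinAt, rfl⟩

lemma hasPd_const (c : ℝ) : HasPd K i (fun _ => c) 0 x :=
  ⟨0, hasFDerivWithinAt_const c x K, rfl⟩

lemma HasPd.add (hf : HasPd K i f f' x) (hg : HasPd K i g g' x) :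
    HasPd K i (fun z => f z + g z) (f' + g') x := by
  obtain ⟨L, hL, rfl⟩ := hf
  obtain ⟨L', hL', rfl⟩ := hg
  exact ⟨_, hL.add hL', rfl⟩

lemma HasPd.sub (hf : HasPd K i f f' x) (hg : HasPd K i g g' x) :
    HasPd K i (fun z => f z - g z) (f' - g') x := by
  obtain ⟨L, hL, rfl⟩ := hf
  obtain ⟨L', hL', rfl⟩ := hg
  exact ⟨_, hL.sub hL', rfl⟩

lemma HasPd.mul (hf : HasPd K i f f' x) (hg : HasPd K i g g' x) :
    HasPd K i (fun z => f z * g z) (f' * g x + f x * g') x := by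
  obtain ⟨L, hL, rfl⟩ := hf
  obtain ⟨L', hL', rfl⟩ := hg
  refine ⟨_, hL.mul hL', ?_⟩
  simp
  ring

lemma HasPd.const_mul (c : ℝ) (hf : HasPd K i f f' x) :
    HasPd K i (fun z => c * f z) (c * f') x := by
  simpa using (hasPd_const c).mul hf

lemma HasPd.comp_hasDerivAt {φ : ℝ → ℝ} {φ' : ℝ} (hφ : HasDerivAt φ φ' (f x))
    (hf : HasPd K i f f' x) : HasPd K i (fun z => φ (f z)) (φ' * f') x := by
  obtain ⟨L, hL, rfl⟩ := hf
  exact ⟨_, hφ.comp_hasFDerivWithinAt x hL, rfl⟩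

lemma hasPd_coord (i j : Fin n) : HasPd K i (fun z => z j) (if i = j then 1 else 0) x := by
  have h := (EuclideanSpace.proj j : Coord n →L[ℝ] ℝ).hasFDerivAt (x := x)
  refine ⟨EuclideanSpace.proj j, h.hasFDerivWithinAt, ?_⟩
  simp [eq_comm]

lemma HasPd.congr (hf : HasPd K i f f' x) (h : g =ᶠ[𝓝[K] x] f) (hx : x ∈ K) :
    HasPd K i g f' x := by
  obtain ⟨L, hL, rfl⟩ := hf
  exact ⟨L, hL.congr_of_eventuallyEq h (h.self_of_nhdsWithin hx), rfl⟩

lemma pd_congr (h : f =ᶠ[𝓝[K] x] g) (hx : x ∈ K) : pd K i f x = pd K i g x := by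
  rw [pd, pd, h.fderivWithin_eq_of_mem hx]

end Pd

/-! ### The divergence of a vector field in coordinates -/

lemma trace_rot {G : Coord 3 → Matrix (Fin 3) (Fin 3) ℝ} {x : Coord 3} (hG : (G x)ᵀ = G x)
    (a : Fin 3 → ℝ) : (rot G x a).trace = 0 := by
  have h : ((G x)⁻¹)ᵀ = (G x)⁻¹ := by rw [Matrix.transpose_nonsing_inv, hG]
  have hs : ∀ i j, (G x)⁻¹ i j = (G x)⁻¹ j i := fun i j => congrFun (congrFun h j) i
  simp [Matrix.trace, Fin.sum_univ_three, rot, cross, crossProduct, mulVec, dotProduct,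
    hs 1 0, hs 2 0, hs 2 1]
  ring

/-- Jacobi's formula identifies the contracted Christoffel symbols with the logarithmic derivative
of the volume density, so the divergence of a vector field is minus the codifferential of its dual
form. -/
lemma trace_covDeriv {G : Coord 3 → Matrix (Fin 3) (Fin 3) ℝ} {U : Coord 3 → Fin 3 → ℝ}
    {x : Coord 3} (hx : x ∈ halfSpace)
    (hG : ∀ i j, DifferentiableWithinAt ℝ (fun z => G z i j) halfSpace x)
    (hU : ∀ i, DifferentiableWithinAt ℝ (fun z => U z i) halfSpace x)
    (hsymm : ∀ z, (G z)ᵀ = G z) (hpos : ∀ᶠ z in 𝓝[halfSpace] x, 0 < (G z).det) :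
    (covDeriv G U x).trace = -codiff halfSpace G (lower G U) x := by
  have hK := uniqueDiffOn_halfSpace x hx
  have hd : 0 < (G x).det := hpos.self_of_nhdsWithin hx
  have hs : ∀ z i j, G z i j = G z j i := fun z i j => congrFun (congrFun (hsymm z) j) i
  set D : Fin 3 → Fin 3 → Fin 3 → ℝ := fun i j k => pd halfSpace i (fun z => G z j k) x with hD
  have hDs : ∀ i j k, D i j k = D i k j := fun i j k => by
    simp only [hD]; congr 1; ext z; exact hs z j k
  have hP : ∀ i j k, HasPd halfSpace i (fun z => G z j k) (D i j k) x := fun i j k =>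
    (hG j k).hasPd i
  have hdet : ∀ i, HasPd halfSpace i (fun z => (G z).det)
      ((G x).det * ∑ k, ∑ l, (G x)⁻¹ k l * D i k l) x := by
    intro i
    simp only [Matrix.det_fin_three]
    have h := (((((((hP i 0 0).mul (hP i 1 1)).mul (hP i 2 2)).sub
      (((hP i 0 0).mul (hP i 1 2)).mul (hP i 2 1))).sub
      (((hP i 0 1).mul (hP i 1 0)).mul (hP i 2 2))).add
      (((hP i 0 1).mul (hP i 1 2)).mul (hP i 2 0))).add
      (((hP i 0 2).mul (hP i 1 0)).mul (hP i 2 1))).sub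
      (((hP i 0 2).mul (hP i 1 1)).mul (hP i 2 0))
    convert h using 1
    rw [← Matrix.det_fin_three, Finset.mul_sum]
    have : ∀ k l, (G x)⁻¹ k l = (G x).det⁻¹ * (G x).adjugate k l := by
      intro k l
      rw [Matrix.inv_def, Ring.inverse_eq_inv', Matrix.smul_apply, smul_eq_mul]
    simp only [this, Finset.mul_sum, mul_assoc, mul_inv_cancel_left₀ hd.ne']
    simp only [Fin.sum_univ_three, Matrix.adjugate_fin_three, Matrix.of_apply, Matrix.cons_val',
      Matrix.cons_val_zero, Matrix.cons_val_one, Matrix.cons_val, hs x 1 0, hs x 2 0, hs x 2 1,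
      hDs i 1 0, hDs i 2 0, hDs i 2 1]
    ring
  have hsq : ∀ i, HasPd halfSpace i (fun z => √(G z).det)
      (√(G x).det * ((1 / 2) * ∑ k, ∑ l, (G x)⁻¹ k l * D i k l)) x := by
    intro i
    have h := HasPd.comp_hasDerivAt (Real.hasDerivAt_sqrt hd.ne') (hdet i)
    convert h using 1
    have h2 : √(G x).det * √(G x).det = (G x).det := Real.mul_self_sqrt hd.le
    have h3 : √(G x).det ≠ 0 := (Real.sqrt_pos.2 hd).ne'
    have h4 : 1 / (2 * √(G x).det) * (G x).det = √(G x).det * (1 / 2) := by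
      rw [div_mul_eq_mul_div, div_eq_iff (by positivity)]
      linear_combination -h2
    rw [← mul_assoc, ← mul_assoc, h4]
  have hcod : ∀ i, pd halfSpace i (fun z => √(G z).det * ((G z)⁻¹ *ᵥ lower G U z) i) x =
      √(G x).det * ((1 / 2) * ∑ k, ∑ l, (G x)⁻¹ k l * D i k l) * U x i +
        √(G x).det * pd halfSpace i (fun z => U z i) x := by
    intro i
    refine HasPd.pd_eq (((hsq i).mul ((hU i).hasPd i)).congr ?_ hx) hK
    filter_upwards [hpos] with z hz
    rw [lower, Matrix.mulVec_mulVec, Matrix.nonsing_inv_mul _ (Ne.isUnit hz.ne'), Matrix.one_mulVec]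
  have h3 : √(G x).det ≠ 0 := (Real.sqrt_pos.2 hd).ne'
  have hinv : ((G x)⁻¹)ᵀ = (G x)⁻¹ := by rw [Matrix.transpose_nonsing_inv, hsymm]
  have hsi : ∀ i j, (G x)⁻¹ i j = (G x)⁻¹ j i := fun i j => congrFun (congrFun hinv j) i
  rw [codiff]
  simp only [hcod]
  simp only [Matrix.trace, Matrix.diag, covDeriv, Matrix.of_apply, christoffel]
  change ∑ k, (pd halfSpace k (fun z => U z k) x +
    ∑ j, (1 / 2 * ∑ l, (G x)⁻¹ k l * (D k j l + D j k l - D l k j)) * U x j) = _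
  simp only [← mul_add, mul_assoc, ← Finset.mul_sum]
  rw [neg_mul, neg_neg, inv_mul_cancel_left₀ h3]
  simp only [Fin.sum_univ_three, hsi 1 0, hsi 2 0, hsi 2 1, hDs _ 1 0, hDs _ 2 0, hDs _ 2 1]
  ring

/-! ### Diagonal metrics depending on one coordinate -/

/-- At the point `x` the metric is `diag(p², q², r²)`, and its first derivatives are those of a
diagonal metric that depends on `x₀` only, `p'`, `q'`, `r'` being the derivatives of `p`, `q`,
`r`. -/
structure IsWarpedAt (G : Coord 3 → Matrix (Fin 3) (Fin 3) ℝ) (x : Coord 3)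
    (p q r p' q' r' : ℝ) : Prop where
  p_pos : 0 < p
  q_pos : 0 < q
  r_pos : 0 < r
  val : G x = Matrix.diagonal ![p ^ 2, q ^ 2, r ^ 2]
  deriv : ∀ i j l, pd halfSpace i (fun z => G z j l) x =
    if i = 0 then Matrix.diagonal ![2 * p * p', 2 * q * q', 2 * r * r'] j l else 0

namespace IsWarpedAt

variable {G : Coord 3 → Matrix (Fin 3) (Fin 3) ℝ} {x : Coord 3} {p q r p' q' r' : ℝ}

lemma inv (h : IsWarpedAt G x p q r p' q' r') :
    (G x)⁻¹ = Matrix.diagonal ![(p ^ 2)⁻¹, (q ^ 2)⁻¹, (r ^ 2)⁻¹] := by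
  have := h.p_pos.ne'
  have := h.q_pos.ne'
  have := h.r_pos.ne'
  refine Matrix.inv_eq_right_inv ?_
  rw [h.val, Matrix.diagonal_mul_diagonal, ← Matrix.diagonal_one]
  congr 1
  ext i
  fin_cases i <;> simp <;> field_simp

lemma sqrt_det (h : IsWarpedAt G x p q r p' q' r') : √(G x).det = p * q * r := by
  have : (G x).det = (p * q * r) ^ 2 := by
    rw [h.val, Matrix.det_diagonal, Fin.prod_univ_three]
    simp
    ring
  rw [this, Real.sqrt_sq (mul_pos (mul_pos h.p_pos h.q_pos) h.r_pos).le]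

lemma christoffel_eq (h : IsWarpedAt G x p q r p' q' r') (k i j : Fin 3) :
    christoffel G k i j x =
      (![!![p' / p, 0, 0; 0, -(q * q') / p ^ 2, 0; 0, 0, -(r * r') / p ^ 2],
        !![0, q' / q, 0; q' / q, 0, 0; 0, 0, 0],
        !![0, 0, r' / r; 0, 0, 0; r' / r, 0, 0]] : Fin 3 → Matrix (Fin 3) (Fin 3) ℝ) k i j := by
  have := h.p_pos.ne'
  have := h.q_pos.ne'
  have := h.r_pos.ne'
  simp only [christoffel, h.inv, h.deriv, Fin.sum_univ_three]
  fin_cases k <;> fin_cases i <;> fin_cases j <;> simp <;> field_simp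

lemma cross_eq (h : IsWarpedAt G x p q r p' q' r') (a b : Fin 3 → ℝ) :
    cross G x a b = ![q * r / p * (a 1 * b 2 - a 2 * b 1), p * r / q * (a 2 * b 0 - a 0 * b 2),
      p * q / r * (a 0 * b 1 - a 1 * b 0)] := by
  have := h.p_pos.ne'
  have := h.q_pos.ne'
  have := h.r_pos.ne'
  rw [cross, h.sqrt_det, h.inv]
  ext k
  fin_cases k <;> simp [Matrix.mulVec_diagonal, crossProduct] <;> field_simp

variable {W W' : Coord 3 → Matrix (Fin 3) (Fin 3) ℝ}

/-- The equations `d_E Ω = 0`, `δ_E Ω = 0` express the differential of the divergence `f` of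
`Ω = W + i W'` through the antisymmetric parts of `W` and `W'`: `df + curl A = -2 A'`. -/
lemma grad_trace (h : IsWarpedAt G x p q r p' q' r')
    (hd : ∀ i j, dEOneRe G W W' i j x = 0) (hδ : deltaERe G W W' x = 0)
    {D : Fin 3 → Fin 3 → Fin 3 → ℝ}
    (hD : ∀ i k j, pd halfSpace i (fun z => W z k j) x = D i k j) :
    q * r / p * (D 0 0 0 + D 0 1 1 + D 0 2 2)
      + r / (p * q) * (p ^ 2 * D 1 0 1 - q ^ 2 * D 1 1 0)
      - q / (p * r) * (r ^ 2 * D 2 2 0 - p ^ 2 * D 2 0 2)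
      = -2 * (q ^ 2 * W' x 1 2 - r ^ 2 * W' x 2 1) ∧
    p * r / q * (D 1 0 0 + D 1 1 1 + D 1 2 2)
      + p / (q * r) * (q ^ 2 * D 2 1 2 - r ^ 2 * D 2 2 1)
      - ((r' / (p * q) - r * p' / (p ^ 2 * q) - r * q' / (p * q ^ 2)) *
          (p ^ 2 * W x 0 1 - q ^ 2 * W x 1 0)
        + r / (p * q) * (2 * p * p' * W x 0 1 + p ^ 2 * D 0 0 1
          - (2 * q * q' * W x 1 0 + q ^ 2 * D 0 1 0)))
      = -2 * (r ^ 2 * W' x 2 0 - p ^ 2 * W' x 0 2) ∧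
    p * q / r * (D 2 0 0 + D 2 1 1 + D 2 2 2)
      + ((q' / (p * r) - q * p' / (p ^ 2 * r) - q * r' / (p * r ^ 2)) *
          (r ^ 2 * W x 2 0 - p ^ 2 * W x 0 2)
        + q / (p * r) * (2 * r * r' * W x 2 0 + r ^ 2 * D 0 2 0
          - (2 * p * p' * W x 0 2 + p ^ 2 * D 0 0 2)))
      - p / (q * r) * (q ^ 2 * D 1 1 2 - r ^ 2 * D 1 2 1)
      = -2 * (p ^ 2 * W' x 0 1 - q ^ 2 * W' x 1 0) := by
  have hp := h.p_pos.ne'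
  have hq := h.q_pos.ne'
  have hr := h.r_pos.ne'
  have e := fun i j k => congrFun (hd i j) k
  have eδ := fun k => congrFun hδ k
  simp only [dEOneRe, covDerivEnd, h.christoffel_eq, h.cross_eq, hD, Pi.add_apply, Pi.sub_apply,
    Pi.zero_apply, Fin.sum_univ_three, Matrix.col_apply] at e
  simp only [deltaERe, covDerivEnd, h.christoffel_eq, h.cross_eq, hD, Pi.add_apply, Pi.sub_apply,
    Pi.zero_apply, Finset.sum_apply, Fin.sum_univ_three, Matrix.col_apply, h.inv, Pi.smul_apply,
    Pi.neg_apply, smul_eq_mul] at eδ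
  refine ⟨?_, ?_, ?_⟩
  · have e1 := e 0 1 1
    have e2 := e 0 2 2
    have e3 := eδ 0
    simp at e1 e2 e3
    linear_combination (norm := (field_simp; ring)) q * r / p * (e1 + e2) - p * q * r * e3
  · have e1 := e 1 0 0
    have e2 := e 1 2 2
    have e3 := eδ 1
    simp at e1 e2 e3
    linear_combination (norm := (field_simp; ring)) p * r / q * (e1 + e2) - p * q * r * e3
  · have e1 := e 2 0 0
    have e2 := e 2 1 1
    have e3 := eδ 2
    simp at e1 e2 e3
    linear_combination (norm := (field_simp; ring)) p * q / r * (e1 + e2) - p * q * r * e3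

/-- The alternating part of `d_E Ω = 0`: the antisymmetric part of `W'` has divergence
`-2 tr W`. -/
lemma div_skew (h : IsWarpedAt G x p q r p' q' r')
    (hd : ∀ i j, dEOneIm G W W' i j x = 0) {D : Fin 3 → Fin 3 → Fin 3 → ℝ}
    (hD : ∀ i k j, pd halfSpace i (fun z => W' z k j) x = D i k j) :
    (2 * q * q' * W' x 1 2 + q ^ 2 * D 0 1 2 - (2 * r * r' * W' x 2 1 + r ^ 2 * D 0 2 1))
      + (r ^ 2 * D 1 2 0 - p ^ 2 * D 1 0 2) + (p ^ 2 * D 2 0 1 - q ^ 2 * D 2 1 0)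
      = -2 * (p * q * r) * (W x).trace := by
  have hp := h.p_pos.ne'
  have hq := h.q_pos.ne'
  have hr := h.r_pos.ne'
  have e := fun i j k => congrFun (hd i j) k
  simp only [dEOneIm, covDerivEnd, h.christoffel_eq, h.cross_eq, hD, Pi.add_apply, Pi.sub_apply,
    Pi.zero_apply, Fin.sum_univ_three, Matrix.col_apply] at e
  have e1 := e 0 2 1
  have e2 := e 1 0 2
  have e3 := e 2 1 0
  simp at e1 e2 e3
  simp only [Matrix.trace, Matrix.diag, Fin.sum_univ_three]
  linear_combination (norm := (field_simp; ring)) q ^ 2 * e1 + r ^ 2 * e2 + p ^ 2 * e3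

end IsWarpedAt

/-- The metric `p(x₀)² dx₀² + q(x₀)² dx₁² + r(x₀)² dx₂²`. -/
noncomputable def warpMetric (p q r : ℝ → ℝ) (x : Coord 3) : Matrix (Fin 3) (Fin 3) ℝ :=
  Matrix.diagonal ![p (x 0) ^ 2, q (x 0) ^ 2, r (x 0) ^ 2]

lemma isWarpedAt_of_eventuallyEq {G : Coord 3 → Matrix (Fin 3) (Fin 3) ℝ} {x : Coord 3}
    {p q r : ℝ → ℝ} {p' q' r' : ℝ} (hx : x ∈ halfSpace)
    (hG : G =ᶠ[𝓝[halfSpace] x] warpMetric p q r) (hp : HasDerivAt p p' (x 0))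
    (hq : HasDerivAt q q' (x 0)) (hr : HasDerivAt r r' (x 0)) (hp0 : 0 < p (x 0))
    (hq0 : 0 < q (x 0)) (hr0 : 0 < r (x 0)) :
    IsWarpedAt G x (p (x 0)) (q (x 0)) (r (x 0)) p' q' r' := by
  refine ⟨hp0, hq0, hr0, hG.self_of_nhdsWithin hx, fun i j l => ?_⟩
  have hK := uniqueDiffOn_halfSpace x hx
  have hc := hasPd_coord (K := halfSpace) (x := x) i 0
  have key : HasPd halfSpace i (fun z => warpMetric p q r z j l)
      (if i = 0 then Matrix.diagonal
        ![2 * p (x 0) * p', 2 * q (x 0) * q', 2 * r (x 0) * r'] j l else 0) x := by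
    have h0 : HasPd halfSpace i (fun _ => (0 : ℝ)) 0 x := hasPd_const 0
    fin_cases j <;> fin_cases l <;> simp [warpMetric] <;>
      first
      | exact h0
      | skip
    · convert HasPd.comp_hasDerivAt (hp.fun_pow 2) hc using 1
      split_ifs <;> simp
    · convert HasPd.comp_hasDerivAt (hq.fun_pow 2) hc using 1
      split_ifs <;> simp
    · convert HasPd.comp_hasDerivAt (hr.fun_pow 2) hc using 1
      split_ifs <;> simp
  refine HasPd.pd_eq (key.congr ?_ hx) hK
  filter_upwards [hG] with z hz
  rw [hz]

/-! ### Second derivatives -/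

section Second

variable {n : ℕ} {f : Coord n → ℝ} {x : Coord n}

lemma pd_univ (i : Fin n) : pd univ i f x = fderiv ℝ f x (EuclideanSpace.single i 1) := by
  rw [pd, fderivWithin_univ]

lemma pd_halfSpace_of_pos {f : Coord 3 → ℝ} {x : Coord 3} (hx : 0 < x 0) (i : Fin 3) :
    pd halfSpace i f x = pd univ i f x := by
  rw [pd, pd_univ, fderivWithin_of_mem_nhds]
  have : IsOpen {z : Coord 3 | 0 < z 0} :=
    isOpen_lt continuous_const (EuclideanSpace.proj (0 : Fin 3) : Coord 3 →L[ℝ] ℝ).continuous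
  exact Filter.mem_of_superset (this.mem_nhds hx) fun z (hz : 0 < z 0) => hz.le

lemma _root_.ContDiffAt.pd {m k : WithTop ℕ∞} (hf : ContDiffAt ℝ m f x) (hk : k + 1 ≤ m) (i : Fin n) :
    ContDiffAt ℝ k (fun z => HarmonicDeformation.pd univ i f z) x := by
  simp only [pd_univ]
  exact (hf.fderiv_right hk).clm_apply contDiffAt_const

lemma pd_comm (hf : ContDiffAt ℝ 2 f x) (i j : Fin n) :
    pd univ i (fun z => pd univ j f z) x = pd univ j (fun z => pd univ i f z) x := by
  have hs := hf.isSymmSndFDerivAt (by simp)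
  have hd : DifferentiableAt ℝ (fderiv ℝ f) x :=
    (hf.fderiv_right (m := 1) (by norm_num)).differentiableAt (by simp)
  have key : ∀ i j : Fin n, pd univ i (fun z => pd univ j f z) x =
      fderiv ℝ (fderiv ℝ f) x (EuclideanSpace.single i 1) (EuclideanSpace.single j 1) := by
    intro i j
    simp only [pd_univ]
    have := (hd.hasFDerivAt.clm_apply (hasFDerivAt_const (EuclideanSpace.single j (1 : ℝ)) x))
    rw [this.fderiv]
    simp
  rw [key, key]
  exact hs _ _

/-- Second derivative test. -/
lemma _root_.IsLocalMax.pd_pd_nonpos (hf : ContDiffAt ℝ 2 f x) (hm : IsLocalMax f x) (i : Fin n) :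
    pd univ i (fun z => pd univ i f z) x ≤ 0 := by
  set e : Coord n := EuclideanSpace.single i 1
  set γ : ℝ → Coord n := fun t => x + t • e
  have hγ : ∀ t, HasDerivAt γ e t := fun t => by
    simpa [γ] using ((hasDerivAt_id t).smul_const e).const_add x
  have hγ0 : γ 0 = x := by simp [γ]
  have hγc : ContinuousAt γ 0 := (hγ 0).continuousAt
  have hev : ∀ᶠ z in 𝓝 x, DifferentiableAt ℝ f z := by
    filter_upwards [hf.eventually (by simp)] with z hz using hz.differentiableAt (by simp)
  have hev' : ∀ᶠ t in 𝓝 (0 : ℝ), DifferentiableAt ℝ f (γ t) := by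
    refine hγc.eventually ?_
    rwa [hγ0]
  have hd1 : deriv (f ∘ γ) =ᶠ[𝓝 0] fun t => pd univ i f (γ t) := by
    filter_upwards [hev'] with t ht
    rw [pd_univ]
    exact (ht.hasFDerivAt.comp_hasDerivAt t (hγ t)).deriv
  have hd2 : deriv (deriv (f ∘ γ)) 0 = pd univ i (fun z => pd univ i f z) x := by
    rw [hd1.deriv_eq]
    have h1 : DifferentiableAt ℝ (fun z => pd univ i f z) (γ 0) := by
      rw [hγ0]
      exact (hf.pd (k := 1) (by norm_num) i).differentiableAt (by simp)
    have h2 := (h1.hasFDerivAt.comp_hasDerivAt 0 (hγ 0)).deriv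
    rw [hγ0, ← pd_univ] at h2
    exact h2
  have hmγ : IsLocalMax (f ∘ γ) 0 := by
    have : ∀ᶠ t in 𝓝 (0 : ℝ), f (γ t) ≤ f x := hγc.eventually (by rw [hγ0]; exact hm)
    simpa [IsLocalMax, IsMaxFilter, hγ0] using this
  by_contra hcon
  push Not at hcon
  rw [← hd2] at hcon
  have hcont : ContinuousAt (f ∘ γ) 0 := by
    refine ContinuousAt.comp ?_ hγc
    rw [hγ0]
    exact hf.continuousAt
  have hmin := isLocalMin_of_deriv_deriv_pos hcon hmγ.deriv_eq_zero hcont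
  have hconst : f ∘ γ =ᶠ[𝓝 0] fun _ => (f ∘ γ) 0 := by
    filter_upwards [hmγ, hmin] with t h1 h2 using le_antisymm h1 h2
  have h0 : deriv (deriv (f ∘ γ)) 0 = 0 := by
    rw [hconst.deriv.deriv_eq]
    simp
  exact hcon.ne' h0

lemma _root_.IsLocalMax.pd_eq_zero (hm : IsLocalMax f x) (i : Fin n) : pd univ i f x = 0 := by
  rw [pd_univ, hm.fderiv_eq_zero]
  rfl

end Second

/-! ### The maximum principle in the interior -/

/-- Derivative of an antisymmetric part with one index lowered by `diag(p², q², r²)`; all coefficients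
depend on the first coordinate only. -/
lemma hasPd_skew {K : Set (Coord 3)} {z : Coord 3} {i : Fin 3} {c a b : ℝ → ℝ} {c' a' b' : ℝ}
    {E F : Coord 3 → ℝ} {E' F' : ℝ} (hc : HasDerivAt c c' (z 0)) (ha : HasDerivAt a a' (z 0))
    (hb : HasDerivAt b b' (z 0)) (hE : HasPd K i E E' z) (hF : HasPd K i F F' z) :
    HasPd K i (fun z => c (z 0) * (a (z 0) ^ 2 * E z - b (z 0) ^ 2 * F z))
      ((if i = 0 then c' else 0) * (a (z 0) ^ 2 * E z - b (z 0) ^ 2 * F z) + c (z 0) *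
        (((if i = 0 then 2 * a (z 0) * a' else 0) * E z + a (z 0) ^ 2 * E') -
        ((if i = 0 then 2 * b (z 0) * b' else 0) * F z + b (z 0) ^ 2 * F'))) z := by
  have h0 := hasPd_coord (K := K) (x := z) i 0
  convert (h0.comp_hasDerivAt hc).mul (((h0.comp_hasDerivAt (ha.fun_pow 2)).mul hE).sub
    ((h0.comp_hasDerivAt (hb.fun_pow 2)).mul hF)) using 1
  split_ifs <;> simp

lemma hasDerivAt_div_mul {a b c : ℝ → ℝ} {a' b' c' t : ℝ} (ha : HasDerivAt a a' t)
    (hb : HasDerivAt b b' t) (hc : HasDerivAt c c' t) (hb0 : b t ≠ 0) (hc0 : c t ≠ 0) :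
    HasDerivAt (fun t => a t / (b t * c t))
      (a' / (b t * c t) - a t * b' / (b t ^ 2 * c t) - a t * c' / (b t * c t ^ 2)) t := by
  refine (ha.fun_div (hb.fun_mul hc) (mul_ne_zero hb0 hc0)).congr_deriv ?_
  field_simp
  ring

/-- At a critical point of `f`, the derivative of a multiple of `∂ᵢ f` involves no derivative of the
factor. -/
lemma hasPd_mul_pd {n : ℕ} {f c : Coord n → ℝ} {x : Coord n} {i : Fin n} (hf : ContDiffAt ℝ 2 f x)
    (hc : ContDiffAt ℝ 2 c x) (h0 : pd univ i f x = 0) :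
    HasPd univ i (fun z => c z * pd univ i f z) (c x * pd univ i (fun z => pd univ i f z) x) x := by
  have h1 := ((hf.pd (k := 1) (by norm_num) i).differentiableAt
    (by simp)).differentiableWithinAt (s := univ)
  have h2 := (hc.differentiableAt (by simp)).differentiableWithinAt (s := univ)
  have h := (h2.hasPd i).mul (h1.hasPd i)
  rwa [h0, mul_zero, zero_add] at h

/-- For harmonic `Ω` the divergence `f = tr W` satisfies `Δ f = 4 f`; this is the equation at a
critical point of `f`. -/
lemma laplace_trace {G W W' : Coord 3 → Matrix (Fin 3) (Fin 3) ℝ} {x : Coord 3} {p q r : ℝ → ℝ}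
    (hx : 0 < x 0) (hG : ∀ᶠ z in 𝓝 x, G =ᶠ[𝓝[halfSpace] z] warpMetric p q r)
    (hp : ContDiffAt ℝ 2 p (x 0)) (hq : ContDiffAt ℝ 2 q (x 0)) (hr : ContDiffAt ℝ 2 r (x 0))
    (hp0 : 0 < p (x 0)) (hq0 : 0 < q (x 0)) (hr0 : 0 < r (x 0))
    (hW : ∀ i j, ContDiffAt ℝ 2 (fun z => W z i j) x)
    (hW' : ∀ i j, ContDiffAt ℝ 2 (fun z => W' z i j) x)
    (hd : ∀ᶠ z in 𝓝 x, ∀ i j, dEOneRe G W W' i j z = 0)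
    (hdi : ∀ i j, dEOneIm G W W' i j x = 0)
    (hδ : ∀ᶠ z in 𝓝 x, deltaERe G W W' z = 0)
    (hcrit : ∀ i, pd univ i (fun z => (W z).trace) x = 0) :
    q (x 0) * r (x 0) / p (x 0) * pd univ 0 (fun z => pd univ 0 (fun z => (W z).trace) z) x
    + p (x 0) * r (x 0) / q (x 0) * pd univ 1 (fun z => pd univ 1 (fun z => (W z).trace) z) x
    + p (x 0) * q (x 0) / r (x 0) * pd univ 2 (fun z => pd univ 2 (fun z => (W z).trace) z) x
    = 4 * (p (x 0) * q (x 0) * r (x 0)) * (W x).trace := by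
  have hcoord : ContDiffAt ℝ 2 (fun z : Coord 3 => z 0) x :=
    (EuclideanSpace.proj (0 : Fin 3) : Coord 3 →L[ℝ] ℝ).contDiff.contDiffAt
  have hc0 : ContinuousAt (fun z : Coord 3 => z 0) x := hcoord.continuousAt
  have hP : ContDiffAt ℝ 2 (fun z : Coord 3 => p (z 0)) x := hp.comp x hcoord
  have hQ : ContDiffAt ℝ 2 (fun z : Coord 3 => q (z 0)) x := hq.comp x hcoord
  have hR : ContDiffAt ℝ 2 (fun z : Coord 3 => r (z 0)) x := hr.comp x hcoord
  set f : Coord 3 → ℝ := fun z => (W z).trace with hfdef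
  have hf : ContDiffAt ℝ 2 f x := by
    simp only [hfdef, Matrix.trace, Matrix.diag]
    exact ContDiffAt.sum fun i _ => hW i i
  -- the `1`-form `A` dual to the antisymmetric part of `W`
  set A0 : Coord 3 → ℝ := fun z => p (z 0) / (q (z 0) * r (z 0)) *
    (q (z 0) ^ 2 * W z 1 2 - r (z 0) ^ 2 * W z 2 1) with hA0
  set A1 : Coord 3 → ℝ := fun z => q (z 0) / (p (z 0) * r (z 0)) *
    (r (z 0) ^ 2 * W z 2 0 - p (z 0) ^ 2 * W z 0 2) with hA1
  set A2 : Coord 3 → ℝ := fun z => r (z 0) / (p (z 0) * q (z 0)) *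
    (p (z 0) ^ 2 * W z 0 1 - q (z 0) ^ 2 * W z 1 0) with hA2
  have cA0 : ContDiffAt ℝ 2 A0 x := (hP.div (hQ.mul hR) (by positivity)).mul
    (((hQ.pow 2).mul (hW 1 2)).sub ((hR.pow 2).mul (hW 2 1)))
  have cA1 : ContDiffAt ℝ 2 A1 x := (hQ.div (hP.mul hR) (by positivity)).mul
    (((hR.pow 2).mul (hW 2 0)).sub ((hP.pow 2).mul (hW 0 2)))
  have cA2 : ContDiffAt ℝ 2 A2 x := (hR.div (hP.mul hQ) (by positivity)).mul
    (((hP.pow 2).mul (hW 0 1)).sub ((hQ.pow 2).mul (hW 1 0)))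
  set B0 : Coord 3 → ℝ := fun z => 1 * (q (z 0) ^ 2 * W' z 1 2 - r (z 0) ^ 2 * W' z 2 1) with hB0
  set B1 : Coord 3 → ℝ := fun z => 1 * (r (z 0) ^ 2 * W' z 2 0 - p (z 0) ^ 2 * W' z 0 2) with hB1
  set B2 : Coord 3 → ℝ := fun z => 1 * (p (z 0) ^ 2 * W' z 0 1 - q (z 0) ^ 2 * W' z 1 0) with hB2
  have good : ∀ᶠ t in 𝓝 (x 0), (DifferentiableAt ℝ p t ∧ 0 < p t) ∧
      (DifferentiableAt ℝ q t ∧ 0 < q t) ∧ (DifferentiableAt ℝ r t ∧ 0 < r t) := by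
    have aux : ∀ {u : ℝ → ℝ}, ContDiffAt ℝ 2 u (x 0) → 0 < u (x 0) →
        ∀ᶠ t in 𝓝 (x 0), DifferentiableAt ℝ u t ∧ 0 < u t := fun {u} hu h0 => by
      filter_upwards [hu.eventually (by simp), hu.continuousAt.eventually_const_lt h0] with t h1 h2
      exact ⟨h1.differentiableAt (by simp), h2⟩
    exact (aux hp hp0).and ((aux hq hq0).and (aux hr hr0))
  have dW : ∀ᶠ z in 𝓝 x, ∀ i j, DifferentiableAt ℝ (fun z => W z i j) z := by
    simp only [Filter.eventually_all]
    intro i j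
    filter_upwards [(hW i j).eventually (by simp)] with z hz using hz.differentiableAt (by simp)
  have hxpos : ∀ᶠ z in 𝓝 x, 0 < z 0 := hc0.eventually_const_lt hx
  have key : ∀ᶠ z in 𝓝 x,
      q (z 0) * r (z 0) / p (z 0) * pd univ 0 f z + pd univ 1 A2 z - pd univ 2 A1 z =
        -2 * B0 z ∧
      p (z 0) * r (z 0) / q (z 0) * pd univ 1 f z + pd univ 2 A0 z - pd univ 0 A2 z =
        -2 * B1 z ∧
      p (z 0) * q (z 0) / r (z 0) * pd univ 2 f z + pd univ 0 A1 z - pd univ 1 A0 z =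
        -2 * B2 z := by
    filter_upwards [hc0.eventually good, dW, hxpos, hG, hd, hδ] with z hz hdW hz0 hGz hdz hδz
    obtain ⟨⟨dp, pp⟩, ⟨dq, qp⟩, ⟨dr, rp⟩⟩ := hz
    have hw := isWarpedAt_of_eventuallyEq hz0.le hGz dp.hasDerivAt dq.hasDerivAt dr.hasDerivAt
      pp qp rp
    have hD : ∀ i k j, HasPd univ i (fun z => W z k j) (pd univ i (fun z => W z k j) z) z :=
      fun i k j => (hdW k j).differentiableWithinAt.hasPd i
    obtain ⟨e0, e1, e2⟩ := hw.grad_trace hdz hδz (fun i k j => pd_halfSpace_of_pos hz0 i)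
    have c0 := hasDerivAt_div_mul dp.hasDerivAt dq.hasDerivAt dr.hasDerivAt qp.ne' rp.ne'
    have c1 := hasDerivAt_div_mul dq.hasDerivAt dp.hasDerivAt dr.hasDerivAt pp.ne' rp.ne'
    have c2 := hasDerivAt_div_mul dr.hasDerivAt dp.hasDerivAt dq.hasDerivAt pp.ne' qp.ne'
    have hu : UniqueDiffWithinAt ℝ (univ : Set (Coord 3)) z := uniqueDiffWithinAt_univ
    have pf : ∀ i, pd univ i f z = pd univ i (fun z => W z 0 0) z + pd univ i (fun z => W z 1 1) z +
        pd univ i (fun z => W z 2 2) z := by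
      intro i
      simp only [hfdef, Matrix.trace, Matrix.diag, Fin.sum_univ_three]
      exact (((hD i 0 0).add (hD i 1 1)).add (hD i 2 2)).pd_eq hu
    have a0 := fun i => (hasPd_skew c0 dq.hasDerivAt dr.hasDerivAt (hD i 1 2) (hD i 2 1)).pd_eq hu
    have a1 := fun i => (hasPd_skew c1 dr.hasDerivAt dp.hasDerivAt (hD i 2 0) (hD i 0 2)).pd_eq hu
    have a2 := fun i => (hasPd_skew c2 dp.hasDerivAt dq.hasDerivAt (hD i 0 1) (hD i 1 0)).pd_eq hu
    simp only [pf, hA0, hA1, hA2, a0, a1, a2, hB0, hB1, hB2]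
    simp only [one_ne_zero, if_false, if_true, show (2 : Fin 3) ≠ 0 by decide]
    refine ⟨?_, ?_, ?_⟩
    · linear_combination e0
    · linear_combination e1
    · linear_combination e2
  have hu : UniqueDiffWithinAt ℝ (univ : Set (Coord 3)) x := uniqueDiffWithinAt_univ
  have dpd : ∀ {A : Coord 3 → ℝ}, ContDiffAt ℝ 2 A x → ∀ i j,
      HasPd univ i (fun z => pd univ j A z) (pd univ i (fun z => pd univ j A z) x) x :=
    fun hA i j => ((hA.pd (k := 1) (by norm_num) j).differentiableAt
      (by simp)).differentiableWithinAt.hasPd i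
  have hD' : ∀ i k j, HasPd univ i (fun z => W' z k j) (pd univ i (fun z => W' z k j) x) x :=
    fun i k j => ((hW' k j).differentiableAt (by simp)).differentiableWithinAt.hasPd i
  obtain ⟨⟨dp, pp⟩, ⟨dq, qp⟩, ⟨dr, rp⟩⟩ := good.self_of_nhds
  have hk : ∀ {F E : Coord 3 → ℝ} {F' E' : ℝ} {i : Fin 3}, HasPd univ i F F' x →
      HasPd univ i E E' x → F =ᶠ[𝓝 x] E → F' = E' := fun hF hE h => by
    rw [← hF.pd_eq hu, ← hE.pd_eq hu]
    exact pd_congr (by rwa [nhdsWithin_univ]) (mem_univ _)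
  have b0 := (hasPd_skew (hasDerivAt_const (x 0) (1 : ℝ)) dq.hasDerivAt dr.hasDerivAt (hD' 0 1 2)
    (hD' 0 2 1)).const_mul (-2)
  have b1 := (hasPd_skew (hasDerivAt_const (x 0) (1 : ℝ)) dr.hasDerivAt dp.hasDerivAt (hD' 1 2 0)
    (hD' 1 0 2)).const_mul (-2)
  have b2 := (hasPd_skew (hasDerivAt_const (x 0) (1 : ℝ)) dp.hasDerivAt dq.hasDerivAt (hD' 2 0 1)
    (hD' 2 1 0)).const_mul (-2)
  have k0 := hk (((hasPd_mul_pd hf ((hQ.mul hR).div hP pp.ne') (hcrit 0)).add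
    (dpd cA2 0 1)).sub (dpd cA1 0 2)) b0 (key.mono fun z hz => hz.1)
  have k1 := hk (((hasPd_mul_pd hf ((hP.mul hR).div hQ qp.ne') (hcrit 1)).add
    (dpd cA0 1 2)).sub (dpd cA2 1 0)) b1 (key.mono fun z hz => hz.2.1)
  have k2 := hk (((hasPd_mul_pd hf ((hP.mul hQ).div hR rp.ne') (hcrit 2)).add
    (dpd cA1 2 0)).sub (dpd cA0 2 1)) b2 (key.mono fun z hz => hz.2.2)
  have hw := isWarpedAt_of_eventuallyEq hx.le hG.self_of_nhds dp.hasDerivAt dq.hasDerivAt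
    dr.hasDerivAt pp qp rp
  have e := hw.div_skew hdi (fun i k j => pd_halfSpace_of_pos hx i)
  have s0 := pd_comm cA0 1 2
  have s1 := pd_comm cA1 0 2
  have s2 := pd_comm cA2 0 1
  simp only [one_ne_zero, if_false, if_true, show (2 : Fin 3) ≠ 0 by decide, Pi.div_apply] at k0 k1 k2
  linear_combination k0 + k1 + k2 - 2 * e - s0 + s1 - s2

/-! ### The boundary surface -/

section Boundary

lemma hasFDerivAt_bd (y : Coord 2) : ∃ L : Coord 2 →L[ℝ] Coord 3,
    HasFDerivAt bd L y ∧ ∀ a : Fin 2,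
      L (EuclideanSpace.single a 1) = EuclideanSpace.single a.succ 1 := by
  let L : Coord 2 →ₗ[ℝ] Coord 3 :=
    { toFun := bd
      map_add' := fun a b => by ext i; fin_cases i <;> simp [bd]
      map_smul' := fun c a => by ext i; fin_cases i <;> simp [bd] }
  refine ⟨L.toContinuousLinearMap, L.toContinuousLinearMap.hasFDerivAt, fun a => ?_⟩
  change bd _ = _
  ext i
  fin_cases a <;> fin_cases i <;> simp [bd]

lemma contDiff_bd {n : WithTop ℕ∞} : ContDiff ℝ n bd := by
  rw [contDiff_euclidean]
  intro i
  fin_cases i <;> simp [bd] <;> fun_prop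

lemma bd_mem_halfSpace (y : Coord 2) : bd y ∈ halfSpace := by simp [bd, halfSpace]

lemma bd_of_coord_zero {x : Coord 3} (hx : x 0 = 0) : bd !₂[x 1, x 2] = x := by
  ext i
  fin_cases i
  · simpa [bd] using hx.symm
  · simp [bd]
  · simp [bd]

lemma HasPd.comp_bd {f : Coord 3 → ℝ} {f' : ℝ} {y : Coord 2} {a : Fin 2}
    (hf : HasPd halfSpace a.succ f f' (bd y)) : HasPd univ a (fun z => f (bd z)) f' y := by
  obtain ⟨L, hL, rfl⟩ := hf
  obtain ⟨L', hL', he⟩ := hasFDerivAt_bd y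
  refine ⟨L.comp L', ?_, by simp [he]⟩
  exact hL.comp y hL'.hasFDerivWithinAt fun z _ => bd_mem_halfSpace z

lemma tendsto_bd (y : Coord 2) : Filter.Tendsto bd (𝓝 y) (𝓝[halfSpace] (bd y)) :=
  tendsto_nhdsWithin_iff.2 ⟨(contDiff_bd (n := 0)).continuous.continuousAt,
    Filter.Eventually.of_forall bd_mem_halfSpace⟩

lemma eventually_bd_mem {M : Type*} [TopologicalSpace M] [ChartedSpace (EuclideanHalfSpace 3) M]
    {φ : Chart M} {y : Coord 2} (hy : bd y ∈ chartImage φ) : ∀ᶠ z in 𝓝 y, bd z ∈ chartImage φ :=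
  (tendsto_bd y).eventually (chartImage_mem_nhdsWithin φ hy)

lemma contDiffAt_comp_bd {M : Type*} [TopologicalSpace M]
    [ChartedSpace (EuclideanHalfSpace 3) M] {φ : Chart M} {f : Coord 3 → ℝ} {y : Coord 2} {n : ℕ}
    (hf : ContDiffOn ℝ ∞ f (chartImage φ)) (hy : bd y ∈ chartImage φ) :
    ContDiffAt ℝ n (fun z => f (bd z)) y :=
  (((hf (bd y) hy).of_le (by exact_mod_cast le_top)).comp y
    (contDiff_bd.contDiffWithinAt (s := bd ⁻¹' chartImage φ)) fun z hz => hz).contDiffAt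
    (eventually_bd_mem hy)

lemma pd_const_mul {n : ℕ} {K : Set (Coord n)} {x : Coord n} (hK : UniqueDiffWithinAt ℝ K x)
    (i : Fin n) (c : ℝ) (f : Coord n → ℝ) : pd K i (fun z => c * f z) x = c * pd K i f x := by
  have h := fderivWithin_const_smul_field (𝕜 := ℝ) (f := f) (s := K) (x := x) c hK
  simp only [pd]
  exact DFunLike.congr_fun h (EuclideanSpace.single i 1)

/-- Near `y` the boundary metric is `diag(q², r²)` and the shape operator is `diag(k, l)`. -/
structure IsFlatAt (G : Coord 3 → Matrix (Fin 3) (Fin 3) ℝ) (y : Coord 2) (q r k l : ℝ) :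
    Prop where
  q_pos : 0 < q
  r_pos : 0 < r
  metric : ∀ᶠ z in 𝓝 y, bdMetric G z = Matrix.diagonal ![q ^ 2, r ^ 2]
  shape : ∀ᶠ z in 𝓝 y, shape G z = Matrix.diagonal ![k, l]

namespace IsFlatAt

variable {G : Coord 3 → Matrix (Fin 3) (Fin 3) ℝ} {y : Coord 2} {q r k l : ℝ}

lemma eventually (h : IsFlatAt G y q r k l) : ∀ᶠ z in 𝓝 y, IsFlatAt G z q r k l := by
  filter_upwards [h.metric.eventually_nhds, h.shape.eventually_nhds] with z h1 h2
  exact ⟨h.q_pos, h.r_pos, h1, h2⟩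

lemma sqrt_det_of {A : Matrix (Fin 2) (Fin 2) ℝ} (h : IsFlatAt G y q r k l)
    (hA : A = Matrix.diagonal ![q ^ 2, r ^ 2]) : √A.det = q * r := by
  have : A.det = (q * r) ^ 2 := by
    rw [hA, Matrix.det_diagonal, Fin.prod_univ_two]
    simp
    ring
  rw [this, Real.sqrt_sq (mul_pos h.q_pos h.r_pos).le]

lemma inv_of {A : Matrix (Fin 2) (Fin 2) ℝ} (h : IsFlatAt G y q r k l)
    (hA : A = Matrix.diagonal ![q ^ 2, r ^ 2]) :
    A⁻¹ = Matrix.diagonal ![(q ^ 2)⁻¹, (r ^ 2)⁻¹] := by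
  have := h.q_pos.ne'
  have := h.r_pos.ne'
  refine Matrix.inv_eq_right_inv ?_
  rw [hA, Matrix.diagonal_mul_diagonal, ← Matrix.diagonal_one]
  congr 1
  ext i
  fin_cases i <;> simp <;> field_simp

lemma hodgeStar_eq (h : IsFlatAt G y q r k l) (α : Coord 2 → Fin 2 → ℝ) :
    hodgeStar G α y = ![-(q / r) * α y 1, r / q * α y 0] := by
  have := h.q_pos.ne'
  have := h.r_pos.ne'
  rw [hodgeStar, h.sqrt_det_of h.metric.self_of_nhds, h.inv_of h.metric.self_of_nhds]
  ext i
  fin_cases i <;> simp [Matrix.mulVec_diagonal] <;> field_simp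

lemma shapeForm_eq (h : IsFlatAt G y q r k l) (α : Coord 2 → Fin 2 → ℝ) :
    shapeForm G α y = ![k * α y 0, l * α y 1] := by
  rw [shapeForm, h.shape.self_of_nhds]
  ext i
  fin_cases i <;> simp [Matrix.vecMul_diagonal, mul_comm]

lemma delta_eq (h : IsFlatAt G y q r k l) (α : Coord 2 → Fin 2 → ℝ) :
    delta G α y = -(pd univ 0 (fun z => α z 0) y / q ^ 2 + pd univ 1 (fun z => α z 1) y / r ^ 2) := by
  have := h.q_pos.ne'
  have := h.r_pos.ne'
  have key : ∀ i, pd univ i (fun z => √(bdMetric G z).det * ((bdMetric G z)⁻¹ *ᵥ α z) i) y =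
      q * r * (![(q ^ 2)⁻¹, (r ^ 2)⁻¹] i * pd univ i (fun z => α z i) y) := by
    intro i
    rw [← mul_assoc, ← pd_const_mul uniqueDiffWithinAt_univ]
    refine pd_congr ?_ (mem_univ _)
    rw [nhdsWithin_univ]
    filter_upwards [h.metric] with z hz
    rw [h.sqrt_det_of hz, h.inv_of hz, Matrix.mulVec_diagonal]
    ring
  rw [delta, codiff, h.sqrt_det_of h.metric.self_of_nhds]
  simp only [key, Fin.sum_univ_two]
  simp
  field_simp
  ring

lemma starD_eq (h : IsFlatAt G y q r k l) (α : Coord 2 → Fin 2 → ℝ) :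
    starD G α y = (q * r)⁻¹ * (pd univ 0 (fun z => α z 1) y - pd univ 1 (fun z => α z 0) y) := by
  rw [starD, h.sqrt_det_of h.metric.self_of_nhds]

lemma deltaS_eq (h : IsFlatAt G y q r k l) (α : Coord 2 → Fin 2 → ℝ) :
    deltaS G α y = -(k / q ^ 2 * pd univ 0 (fun z => α z 0) y +
      l / r ^ 2 * pd univ 1 (fun z => α z 1) y) := by
  have h0 : ∀ i, pd univ i (fun z => shapeForm G α z i) y =
      ![k, l] i * pd univ i (fun z => α z i) y := by
    intro i
    rw [← pd_const_mul uniqueDiffWithinAt_univ]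
    refine pd_congr ?_ (mem_univ _)
    rw [nhdsWithin_univ]
    filter_upwards [h.eventually] with z hz
    rw [hz.shapeForm_eq]
    fin_cases i <;> simp
  rw [deltaS, h.delta_eq, h0, h0]
  simp
  ring

/-- On a flat boundary the second boundary condition expresses the function `2 * d σ'` through
`δ_S σ` and `F = δ_S σ - 2 h`: apply `* d * = -δ` to it and use `δ δ d = 0`. -/
lemma curl_of_condition (h : IsFlatAt G y q r k l) {ε : ℝ} {σ σ' : Coord 2 → Fin 2 → ℝ}
    {u : Coord 2 → ℝ} (hσ : ∀ i, ContDiffAt ℝ 3 (fun z => σ z i) y) (hu : ContDiffAt ℝ 2 u y)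
    (hbc : ∀ᶠ z in 𝓝 y, (2 : ℝ) • σ' z - hodgeStar G (fun z => (2 : ℝ) • shapeForm G σ z
      + ε • (laplaceS G σ z - (2 : ℝ) • dS G u z)) z = 0)
    {F : Coord 2 → ℝ} (hF : ∀ z, F z = deltaS G σ z - 2 * u z) :
    2 * (q * r)⁻¹ * (pd univ 0 (fun z => σ' z 1) y - pd univ 1 (fun z => σ' z 0) y) =
      -2 * deltaS G σ y + ε * (k / q ^ 2 * pd univ 0 (fun z => pd univ 0 F z) y +
        l / r ^ 2 * pd univ 1 (fun z => pd univ 1 F z) y) := by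
  have hq := h.q_pos.ne'
  have hr := h.r_pos.ne'
  have hm : ContDiffAt ℝ 2 (starD G σ) y := by
    have : ContDiffAt ℝ 2 (fun z => (q * r)⁻¹ *
        (pd univ 0 (fun z => σ z 1) z - pd univ 1 (fun z => σ z 0) z)) y :=
      contDiffAt_const.mul (((hσ 1).pd (by norm_num) 0).sub ((hσ 0).pd (by norm_num) 1))
    refine this.congr_of_eventuallyEq ?_
    filter_upwards [h.eventually] with z hz using hz.starD_eq σ
  have hS : ContDiffAt ℝ 2 (deltaS G σ) y := by
    have : ContDiffAt ℝ 2 (fun z => -(k / q ^ 2 * pd univ 0 (fun z => σ z 0) z +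
        l / r ^ 2 * pd univ 1 (fun z => σ z 1) z)) y :=
      ((contDiffAt_const.mul ((hσ 0).pd (by norm_num) 0)).add
        (contDiffAt_const.mul ((hσ 1).pd (by norm_num) 1))).neg
    refine this.congr_of_eventuallyEq ?_
    filter_upwards [h.eventually] with z hz using hz.deltaS_eq σ
  have hFc : ContDiffAt ℝ 2 F y := by
    have : F = fun z => deltaS G σ z - 2 * u z := funext hF
    rw [this]
    exact hS.sub (contDiffAt_const.mul hu)
  have hU : ∀ z, UniqueDiffWithinAt ℝ (univ : Set (Coord 2)) z := fun z => uniqueDiffWithinAt_univ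
  have key : ∀ᶠ z in 𝓝 y,
      σ' z 0 = -(q / r) / 2 * (2 * l * σ z 1 + ε * (-(r / q) * pd univ 0 (starD G σ) z +
        l * pd univ 1 F z)) ∧
      σ' z 1 = r / q / 2 * (2 * k * σ z 0 + ε * (q / r * pd univ 1 (starD G σ) z +
        k * pd univ 0 F z)) := by
    filter_upwards [hbc, h.eventually, hS.eventually (by simp), hu.eventually (by simp)]
      with z hz hfl hSz huz
    have hFpd : ∀ i, pd univ i F z = pd univ i (deltaS G σ) z - 2 * pd univ i u z := by
      intro i
      have h1 := (hSz.differentiableAt (by simp)).differentiableWithinAt (s := univ) |>.hasPd i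
      have h2 := (huz.differentiableAt (by simp)).differentiableWithinAt (s := univ) |>.hasPd i
      rw [funext hF]
      exact (h1.sub (h2.const_mul 2)).pd_eq (hU z)
    have e0 := congrFun hz 0
    have e1 := congrFun hz 1
    simp [hfl.hodgeStar_eq, hfl.shapeForm_eq, laplaceS, deltaD, dS, grad] at e0 e1
    rw [hFpd, hFpd]
    constructor
    · linear_combination e0 / 2
    · linear_combination e1 / 2
  have dσ : ∀ i j, HasPd univ i (fun z => σ z j) (pd univ i (fun z => σ z j) y) y := fun i j =>
    ((hσ j).differentiableAt (by simp)).differentiableWithinAt.hasPd i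
  have dd : ∀ {A : Coord 2 → ℝ}, ContDiffAt ℝ 2 A y → ∀ i j,
      HasPd univ i (fun z => pd univ j A z) (pd univ i (fun z => pd univ j A z) y) y :=
    fun hA i j => ((hA.pd (k := 1) (by norm_num) j).differentiableAt
      (by simp)).differentiableWithinAt.hasPd i
  have e0 : pd univ 1 (fun z => σ' z 0) y = -(q / r) / 2 * (2 * l * pd univ 1 (fun z => σ z 1) y +
      ε * (-(r / q) * pd univ 1 (fun z => pd univ 0 (starD G σ) z) y +
        l * pd univ 1 (fun z => pd univ 1 F z) y)) := by
    refine HasPd.pd_eq (HasPd.congr ((((dσ 1 1).const_mul (2 * l)).add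
      ((((dd hm 1 0).const_mul (-(r / q))).add ((dd hFc 1 1).const_mul l)).const_mul ε)).const_mul
      (-(q / r) / 2)) ?_ (mem_univ _)) (hU y)
    rw [nhdsWithin_univ]
    filter_upwards [key] with z hz using hz.1
  have e1 : pd univ 0 (fun z => σ' z 1) y = r / q / 2 * (2 * k * pd univ 0 (fun z => σ z 0) y +
      ε * (q / r * pd univ 0 (fun z => pd univ 1 (starD G σ) z) y +
        k * pd univ 0 (fun z => pd univ 0 F z) y)) := by
    refine HasPd.pd_eq (HasPd.congr ((((dσ 0 0).const_mul (2 * k)).add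
      ((((dd hm 0 1).const_mul (q / r)).add ((dd hFc 0 0).const_mul k)).const_mul ε)).const_mul
      (r / q / 2)) ?_ (mem_univ _)) (hU y)
    rw [nhdsWithin_univ]
    filter_upwards [key] with z hz using hz.2
  have hcomm := pd_comm hm 0 1
  rw [e0, e1, h.deltaS_eq, hcomm]
  field_simp
  ring

end IsFlatAt

end Boundary

/-! ### Diagonal metrics at the boundary -/

namespace IsWarpedAt

variable {G : Coord 3 → Matrix (Fin 3) (Fin 3) ℝ} {x : Coord 3} {p q r p' q' r' : ℝ}

lemma pd_lower (h : IsWarpedAt G x p q r p' q' r') (hx : x ∈ halfSpace)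
    (hG : ∀ i j, DifferentiableWithinAt ℝ (fun z => G z i j) halfSpace x)
    {U : Coord 3 → Fin 3 → ℝ} (hU : ∀ i, DifferentiableWithinAt ℝ (fun z => U z i) halfSpace x)
    (i j : Fin 3) :
    pd halfSpace i (fun z => lower G U z j) x =
      (if i = 0 then ![2 * p * p', 2 * q * q', 2 * r * r'] j else 0) * U x j +
        ![p ^ 2, q ^ 2, r ^ 2] j * pd halfSpace i (fun z => U z j) x := by
  have key := ((((hG j 0).hasPd i).mul ((hU 0).hasPd i)).add (((hG j 1).hasPd i).mul
    ((hU 1).hasPd i))).add (((hG j 2).hasPd i).mul ((hU 2).hasPd i))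
  have hl : (fun z => lower G U z j) = fun z => G z j 0 * U z 0 + G z j 1 * U z 1 +
      G z j 2 * U z 2 := by
    ext z
    simp only [lower, Matrix.mulVec, dotProduct, Fin.sum_univ_three]
  rw [hl, key.pd_eq (uniqueDiffOn_halfSpace x hx)]
  simp only [h.deriv, h.val]
  split_ifs <;> fin_cases j <;> simp

lemma covDeriv_eq (h : IsWarpedAt G x p q r p' q' r') (U : Coord 3 → Fin 3 → ℝ) (k i : Fin 3) :
    covDeriv G U x k i = pd halfSpace i (fun z => U z k) x +
      !![p' / p * U x 0, -(q * q') / p ^ 2 * U x 1, -(r * r') / p ^ 2 * U x 2;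
        q' / q * U x 1, q' / q * U x 0, 0;
        r' / r * U x 2, 0, r' / r * U x 0] k i := by
  simp only [covDeriv, Matrix.of_apply, h.christoffel_eq, Fin.sum_univ_three]
  fin_cases k <;> fin_cases i <;> simp

lemma rot_eq (h : IsWarpedAt G x p q r p' q' r') (a : Fin 3 → ℝ) :
    rot G x a = !![0, -(q * r / p * a 2), q * r / p * a 1;
      p * r / q * a 2, 0, -(p * r / q * a 0);
      -(p * q / r * a 1), p * q / r * a 0, 0] := by
  ext k i
  simp only [rot, Matrix.of_apply, h.cross_eq]
  fin_cases k <;> fin_cases i <;> simp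

/-- Up to the volume density, the tangential components of the antisymmetric part of `Re (d_E s)`
are those of `2 u' - curl u`. -/
lemma skew_dERe (h : IsWarpedAt G x p q r p' q' r') (hx : x ∈ halfSpace)
    (hG : ∀ i j, DifferentiableWithinAt ℝ (fun z => G z i j) halfSpace x)
    {U : Coord 3 → Fin 3 → ℝ} (hU : ∀ i, DifferentiableWithinAt ℝ (fun z => U z i) halfSpace x)
    (U' : Coord 3 → Fin 3 → ℝ) :
    r ^ 2 * dERe G U U' x 2 0 - p ^ 2 * dERe G U U' x 0 2 =
      p * q * r * (2 * U' x 1 - curl G U x 1) ∧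
    p ^ 2 * dERe G U U' x 0 1 - q ^ 2 * dERe G U U' x 1 0 =
      p * q * r * (2 * U' x 2 - curl G U x 2) := by
  have hp := h.p_pos.ne'
  have hq := h.q_pos.ne'
  have hr := h.r_pos.ne'
  simp only [dERe, Matrix.sub_apply, h.covDeriv_eq, h.rot_eq, curl, h.sqrt_det,
    h.pd_lower hx hG hU]
  constructor
  · simp
    field_simp
    ring
  · simp
    field_simp
    ring

/-- The normal component of the antisymmetric part of `Im (d_E s)` is that of `-curl u' - 2 u`, up to
the volume density. -/
lemma skew_dEIm (h : IsWarpedAt G x p q r p' q' r') (hx : x ∈ halfSpace)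
    (hG : ∀ i j, DifferentiableWithinAt ℝ (fun z => G z i j) halfSpace x)
    (U : Coord 3 → Fin 3 → ℝ) {U' : Coord 3 → Fin 3 → ℝ}
    (hU' : ∀ i, DifferentiableWithinAt ℝ (fun z => U' z i) halfSpace x) :
    q ^ 2 * dEIm G U U' x 1 2 - r ^ 2 * dEIm G U U' x 2 1 =
      pd halfSpace 2 (fun z => lower G U' z 1) x - pd halfSpace 1 (fun z => lower G U' z 2) x
        - 2 * (p * q * r) * U x 0 := by
  have hp := h.p_pos.ne'
  have hq := h.q_pos.ne'
  have hr := h.r_pos.ne'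
  simp only [dEIm, Matrix.add_apply, h.covDeriv_eq, h.rot_eq, h.pd_lower hx hG hU']
  simp
  field_simp
  ring

lemma normal_eq (h : IsWarpedAt G x 1 q r p' q' r') : normal G x = Pi.single 0 1 := by
  ext i
  simp only [normal, h.inv]
  fin_cases i <;> simp

end IsWarpedAt

lemma isFlatAt_of_eventuallyEq {G : Coord 3 → Matrix (Fin 3) (Fin 3) ℝ} {y : Coord 2}
    {q r : ℝ → ℝ} {q' r' : ℝ}
    (hG : ∀ᶠ x in 𝓝[halfSpace] (bd y), G x = warpMetric (fun _ => 1) q r x)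
    (hq : ∀ t, 0 ≤ t → DifferentiableAt ℝ q t ∧ 0 < q t) (hq' : deriv q 0 = q')
    (hr : ∀ t, 0 ≤ t → DifferentiableAt ℝ r t ∧ 0 < r t) (hr' : deriv r 0 = r') :
    IsFlatAt G y (q 0) (r 0) (q' / q 0) (r' / r 0) := by
  have hG' := eventually_eventually_nhdsWithin.2 hG
  have hw : ∀ᶠ x in 𝓝[halfSpace] (bd y), IsWarpedAt G x 1 (q (x 0)) (r (x 0)) 0 (deriv q (x 0))
      (deriv r (x 0)) := by
    filter_upwards [hG', self_mem_nhdsWithin] with x hx hxh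
    exact isWarpedAt_of_eventuallyEq (p := fun _ => 1) hxh hx (hasDerivAt_const _ _)
      (hq _ hxh).1.hasDerivAt (hr _ hxh).1.hasDerivAt one_pos (hq _ hxh).2 (hr _ hxh).2
  have hb0 : ∀ z : Coord 2, bd z 0 = 0 := fun z => by simp [bd]
  refine ⟨(hq 0 le_rfl).2, (hr 0 le_rfl).2, ?_, ?_⟩
  · filter_upwards [(tendsto_bd y).eventually hG] with z hz
    rw [bdMetric, hz]
    ext i j
    fin_cases i <;> fin_cases j <;> simp [warpMetric, hb0]
  · filter_upwards [(tendsto_bd y).eventually (eventually_eventually_nhdsWithin.2 hw)] with z hz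
    have hwz := hz.self_of_nhdsWithin (bd_mem_halfSpace z)
    have hn : ∀ i k, pd halfSpace i (fun x => normal G x k) (bd z) = 0 := by
      intro i k
      refine HasPd.pd_eq (HasPd.congr (hasPd_const ((Pi.single 0 1 : Fin 3 → ℝ) k)) ?_
        (bd_mem_halfSpace z)) (uniqueDiffOn_halfSpace _ (bd_mem_halfSpace z))
      filter_upwards [hz] with x hx
      rw [hx.normal_eq]
    ext i j
    rw [shape, Matrix.submatrix_apply, hwz.covDeriv_eq, hn, hwz.normal_eq, hb0, hq', hr']
    fin_cases i <;> fin_cases j <;> simp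

/-! ### The standard forms -/

section Standard

variable {R : ℝ} {a b : ℂ} {x : Coord 3}

lemma trace_standardForm (h : 0 < R + x 0) : (standardForm R a b x).trace = 0 := by
  have hs : ((Real.sinh (R + x 0) : ℝ) : ℂ) ≠ 0 :=
    Complex.ofReal_ne_zero.2 (Real.sinh_pos_iff.2 h).ne'
  have hc : ((Real.cosh (R + x 0) : ℝ) : ℂ) ≠ 0 :=
    Complex.ofReal_ne_zero.2 (Real.cosh_pos _).ne'
  have hcs : ((Real.cosh (R + x 0) : ℝ) : ℂ) ^ 2 = ((Real.sinh (R + x 0) : ℝ) : ℂ) ^ 2 + 1 := by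
    rw [← Complex.ofReal_pow, Real.cosh_sq]
    push_cast
    ring
  simp only [Matrix.trace, Matrix.diag, Fin.sum_univ_three, standardForm, Matrix.of_apply, omegaM,
    omegaL]
  generalize ((Real.sinh (R + x 0) : ℝ) : ℂ) = s at *
  generalize ((Real.cosh (R + x 0) : ℝ) : ℂ) = c at *
  simp
  field_simp
  linear_combination a * hcs

lemma standardForm_symm (h : 0 < R + x 0) :
    standardForm R a b x 0 1 = 0 ∧ standardForm R a b x 1 0 = 0 ∧
    standardForm R a b x 0 2 = 0 ∧ standardForm R a b x 2 0 = 0 ∧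
    ((Real.sinh (R + x 0) ^ 2 : ℝ) : ℂ) * standardForm R a b x 1 2 =
      ((Real.cosh (R + x 0) ^ 2 : ℝ) : ℂ) * standardForm R a b x 2 1 := by
  have hs : ((Real.sinh (R + x 0) : ℝ) : ℂ) ≠ 0 :=
    Complex.ofReal_ne_zero.2 (Real.sinh_pos_iff.2 h).ne'
  have hc : ((Real.cosh (R + x 0) : ℝ) : ℂ) ≠ 0 :=
    Complex.ofReal_ne_zero.2 (Real.cosh_pos _).ne'
  simp only [standardForm, Matrix.of_apply, omegaM, omegaL, Complex.ofReal_pow]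
  generalize ((Real.sinh (R + x 0) : ℝ) : ℂ) = s at *
  generalize ((Real.cosh (R + x 0) : ℝ) : ℂ) = c at *
  refine ⟨by simp, by simp, by simp, by simp, ?_⟩
  simp
  field_simp

end Standard

section Deformation

variable {M : Type*} [TopologicalSpace M] [ChartedSpace (EuclideanHalfSpace 3) M]
  [IsManifold (𝓡∂ 3) ∞ M] {g : RMetric M}
  {o : ∀ p : M, Orientation ℝ (TangentSpace (𝓡∂ 3) p) (Fin 3)} {φ : Chart M}
  {Ω Ω' : EOneForm M} {s : ESection M}

/-! ### The divergence in charts -/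

/-- The divergences of `Ω` and of a cohomologous form differ by the codifferential of the dual of
the infinitesimal translation. -/
lemma trace_endIn_eq (hφ : IsPositiveChart o φ) (hs : EqAddCoboundary g o Ω Ω' s) {x : Coord 3}
    (hx : x ∈ chartImage φ) :
    (endIn φ Ω.re x).trace = (endIn φ Ω'.re x).trace -
      codiff halfSpace (metricIn g φ) (dualIn g φ s.re) x := by
  have hpos : ∀ᶠ z in 𝓝[halfSpace] x, 0 < (metricIn g φ z).det :=
    Filter.mem_of_superset (chartImage_mem_nhdsWithin φ hx) fun z hz => metricIn_det_pos g hφ hz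
  rw [(hs φ hφ x hx).1, Matrix.trace_add, dERe, Matrix.trace_sub,
    trace_rot (metricIn_transpose g φ x),
    trace_covDeriv (chartImage_subset φ hx)
      (fun i j => (contDiffOn_metricIn g hφ.1 i j).differentiableWithinAt_halfSpace hx)
      (fun i => (contDiffOn_fieldIn hφ.1 s.smooth_re i).differentiableWithinAt_halfSpace hx)
      (metricIn_transpose g φ) hpos]
  simp only [dualIn]
  ring

lemma contDiffOn_trace_endIn (hφ : φ ∈ IsManifold.maximalAtlas (𝓡∂ 3) ∞ M) (Ω : EOneForm M) :
    ContDiffOn ℝ ∞ (fun x => (endIn φ Ω.re x).trace) (chartImage φ) := by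
  simp only [Matrix.trace, Matrix.diag]
  exact ContDiffOn.sum fun i _ => contDiffOn_endIn hφ Ω.smooth_re i i

lemma continuous_divergence (hM : IsHyperbolicTubular g o) (Ω : EOneForm M) :
    Continuous (divergence Ω) := by
  rw [continuous_iff_continuousAt]
  intro p
  obtain ⟨φ, hφ, hp⟩ : ∃ φ : Chart M, IsPositiveChart o φ ∧ p ∈ φ.source := by
    have : p ∈ (𝓡∂ 3).interior M ∪ (𝓡∂ 3).boundary M := by
      rw [ModelWithCorners.interior_union_boundary_eq_univ]; exact mem_univ p
    rcases this with h | h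
    · obtain ⟨φ, h1, h2, -⟩ := hM.interior p h
      exact ⟨φ, h1, h2⟩
    · obtain ⟨φ, -, h1, h2, -⟩ := hM.boundary p h
      exact ⟨φ, h1, h2⟩
  have h1 : ContinuousOn (fun q => (endIn φ Ω.re (φ.extend (𝓡∂ 3) q)).trace) φ.source :=
    (contDiffOn_trace_endIn hφ.1 Ω).continuousOn.comp
      ((φ.extend_source (I := 𝓡∂ 3)) ▸ φ.continuousOn_extend) fun q hq => extend_mem_chartImage φ hq
  refine (h1.congr fun q hq => ?_).continuousAt (φ.open_source.mem_nhds hp)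
  have := divergence_pt hφ (extend_mem_chartImage φ hq) Ω
  rwa [pt_extend φ hq] at this

/-- At an interior point no multiple of the divergence has a positive local maximum. -/
lemma mul_divergence_nonpos_of_isLocalMax (hφ : IsPositiveChart o φ) (hΩ : IsHarmonic g o Ω)
    {p q r : ℝ → ℝ} (hG : ∀ x ∈ chartImage φ, metricIn g φ x = warpMetric p q r x)
    {x : Coord 3} (hx : x ∈ chartImage φ) (hx0 : 0 < x 0)
    (hp : ContDiffAt ℝ 2 p (x 0)) (hq : ContDiffAt ℝ 2 q (x 0)) (hr : ContDiffAt ℝ 2 r (x 0))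
    (hp0 : 0 < p (x 0)) (hq0 : 0 < q (x 0)) (hr0 : 0 < r (x 0)) {c : ℝ} (hc : c ≠ 0)
    (hmax : IsLocalMax (fun z => c * (endIn φ Ω.re z).trace) x) :
    c * (endIn φ Ω.re x).trace ≤ 0 := by
  have hnhds : chartImage φ ∈ 𝓝 x := by
    have h1 : {z : Coord 3 | 0 < z 0} ∈ 𝓝 x :=
      (isOpen_lt continuous_const
        (EuclideanSpace.proj (0 : Fin 3) : Coord 3 →L[ℝ] ℝ).continuous).mem_nhds hx0
    filter_upwards [chartImage_eventuallyEq φ hx, h1] with z hz hz0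
    exact hz.mpr (le_of_lt (show 0 < z 0 from hz0))
  have hW : ∀ i j, ContDiffAt ℝ 2 (fun z => endIn φ Ω.re z i j) x := fun i j =>
    contDiffAt_infty.1 ((contDiffOn_endIn hφ.1 Ω.smooth_re i j).contDiffAt hnhds) 2
  have hW' : ∀ i j, ContDiffAt ℝ 2 (fun z => endIn φ Ω.im z i j) x := fun i j =>
    contDiffAt_infty.1 ((contDiffOn_endIn hφ.1 Ω.smooth_im i j).contDiffAt hnhds) 2
  have hf : ContDiffAt ℝ 2 (fun z => (endIn φ Ω.re z).trace) x :=
    contDiffAt_infty.1 ((contDiffOn_trace_endIn hφ.1 Ω).contDiffAt hnhds) 2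
  have hu : ∀ z, UniqueDiffWithinAt ℝ (univ : Set (Coord 3)) z := fun z => uniqueDiffWithinAt_univ
  have hcrit : ∀ i, pd univ i (fun z => (endIn φ Ω.re z).trace) x = 0 := fun i => by
    have := hmax.pd_eq_zero i
    rw [pd_const_mul (hu x)] at this
    exact (mul_eq_zero.1 this).resolve_left hc
  have hsecond : ∀ i, c * pd univ i (fun z => pd univ i (fun z => (endIn φ Ω.re z).trace) z) x ≤ 0 :=
    fun i => by
      have := hmax.pd_pd_nonpos (contDiffAt_const.mul hf) i
      simpa only [pd_const_mul (hu _)] using this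
  have key := laplace_trace hx0
    (by
      filter_upwards [eventually_mem_nhds_iff.2 hnhds] with z hz
      exact Filter.eventually_of_mem (mem_nhdsWithin_of_mem_nhds hz) hG)
    hp hq hr hp0 hq0 hr0 hW hW'
    (by filter_upwards [hnhds] with z hz i j using ((hΩ φ hφ z hz).1 i j).1)
    (fun i j => ((hΩ φ hφ x hx).1 i j).2)
    (by filter_upwards [hnhds] with z hz using (hΩ φ hφ z hz).2.1) hcrit
  have h0 := mul_nonpos_of_nonneg_of_nonpos (by positivity :
    0 ≤ q (x 0) * r (x 0) / p (x 0)) (hsecond 0)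
  have h1 := mul_nonpos_of_nonneg_of_nonpos (by positivity :
    0 ≤ p (x 0) * r (x 0) / q (x 0)) (hsecond 1)
  have h2 := mul_nonpos_of_nonneg_of_nonpos (by positivity :
    0 ≤ p (x 0) * q (x 0) / r (x 0)) (hsecond 2)
  have hpqr : 0 < 4 * (p (x 0) * q (x 0) * r (x 0)) := by positivity
  by_contra hcon
  push Not at hcon
  have := mul_pos hpqr hcon
  have e : 4 * (p (x 0) * q (x 0) * r (x 0)) * (c * (endIn φ Ω.re x).trace) =
    c * (4 * (p (x 0) * q (x 0) * r (x 0)) * (endIn φ Ω.re x).trace) := by ring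
  rw [e, ← key] at this
  linarith

/-! ### The maximum principle at the boundary -/

lemma tubeMetric_eq_warpMetric (R : ℝ) (x : Coord 3) : tubeMetric R x =
    warpMetric (fun _ => 1) (fun t => Real.sinh (R + t)) (fun t => Real.cosh (R + t)) x := by
  simp [tubeMetric, warpMetric]

lemma hasDerivAt_sinh_add (R t : ℝ) :
    HasDerivAt (fun t => Real.sinh (R + t)) (Real.cosh (R + t)) t := by
  simpa using ((hasDerivAt_id t).const_add R).sinh

lemma hasDerivAt_cosh_add (R t : ℝ) :
    HasDerivAt (fun t => Real.cosh (R + t)) (Real.sinh (R + t)) t := by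
  simpa using ((hasDerivAt_id t).const_add R).cosh

lemma IsTubeChart.isWarpedAt {R : ℝ} (hT : IsTubeChart g φ R) {x : Coord 3}
    (hx : x ∈ chartImage φ) :
    IsWarpedAt (metricIn g φ) x 1 (Real.sinh (R + x 0)) (Real.cosh (R + x 0)) 0
      (Real.cosh (R + x 0)) (Real.sinh (R + x 0)) := by
  have hx0 : 0 ≤ x 0 := chartImage_subset φ hx
  have hR := hT.1
  refine isWarpedAt_of_eventuallyEq (p := fun _ => 1) (q := fun t => Real.sinh (R + t))
    (r := fun t => Real.cosh (R + t)) (chartImage_subset φ hx) ?_ (hasDerivAt_const _ _)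
    (hasDerivAt_sinh_add R _) (hasDerivAt_cosh_add R _) one_pos
    (Real.sinh_pos_iff.2 (by linarith)) (Real.cosh_pos _)
  filter_upwards [chartImage_mem_nhdsWithin φ hx] with z hz
  rw [hT.2 z hz, tubeMetric_eq_warpMetric]

lemma IsTubeChart.isFlatAt {R : ℝ} (hT : IsTubeChart g φ R) {y : Coord 2}
    (hy : bd y ∈ chartImage φ) :
    IsFlatAt (metricIn g φ) y (Real.sinh R) (Real.cosh R) (Real.cosh R / Real.sinh R)
      (Real.sinh R / Real.cosh R) := by
  have hR := hT.1
  have h := isFlatAt_of_eventuallyEq (G := metricIn g φ) (y := y)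
    (q := fun t => Real.sinh (R + t)) (r := fun t => Real.cosh (R + t)) (q' := Real.cosh R)
    (r' := Real.sinh R) ?_
    (fun t ht => ⟨(hasDerivAt_sinh_add R t).differentiableAt, Real.sinh_pos_iff.2 (by linarith)⟩)
    (by simpa using (hasDerivAt_sinh_add R 0).deriv)
    (fun t ht => ⟨(hasDerivAt_cosh_add R t).differentiableAt, Real.cosh_pos _⟩)
    (by simpa using (hasDerivAt_cosh_add R 0).deriv)
  · simpa using h
  · filter_upwards [chartImage_mem_nhdsWithin φ hy] with z hz
    rw [hT.2 z hz, tubeMetric_eq_warpMetric]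

/-- The boundary conditions determine the inward normal derivative of the divergence `f` at the
boundary: `∂ₙ f = f / ε + (1 / 2) δ (S d f)`. -/
lemma normal_deriv_trace (hφ : IsPositiveChart o φ) {R : ℝ} (hT : IsTubeChart g φ R) {a b : ℂ}
    (hstd : ∀ x ∈ chartImage φ, endIn φ Ω'.re x = (standardForm R a b x).map Complex.re ∧
      endIn φ Ω'.im x = (standardForm R a b x).map Complex.im)
    (hΩ : IsHarmonic g o Ω) (hs : EqAddCoboundary g o Ω Ω' s) {ε : ℝ} (hε : 0 < ε)
    (hcurl : IsHalfCurlOnBoundary g o s.re s.im) (hbc₁ : BoundaryCondition₁ g o ε s.re)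
    (hbc₂ : BoundaryCondition₂ g o ε s.re s.im) {y : Coord 2} (hy : bd y ∈ chartImage φ)
    {f : Coord 2 → ℝ} (hf : ∀ z, f z = (endIn φ Ω.re (bd z)).trace) :
    pd halfSpace 0 (fun x => (endIn φ Ω.re x).trace) (bd y) = f y / ε -
      1 / 2 * (Real.cosh R / Real.sinh R / Real.sinh R ^ 2 * pd univ 0 (fun z => pd univ 0 f z) y +
        Real.sinh R / Real.cosh R / Real.cosh R ^ 2 * pd univ 1 (fun z => pd univ 1 f z) y) := by
  have hR := hT.1
  have hflat := hT.isFlatAt hy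
  have hb0 : ∀ z : Coord 2, bd z 0 = 0 := fun z => by simp [bd]
  have hwarp : ∀ z, bd z ∈ chartImage φ → IsWarpedAt (metricIn g φ) (bd z) 1 (Real.sinh R)
      (Real.cosh R) 0 (Real.cosh R) (Real.sinh R) := fun z hz => by
    have := hT.isWarpedAt hz
    rwa [hb0, add_zero] at this
  have hev := eventually_bd_mem hy
  have hsp : 0 < Real.sinh R := Real.sinh_pos_iff.2 hR
  have hcp : 0 < Real.cosh R := Real.cosh_pos R
  set q := Real.sinh R with hq
  set r := Real.cosh R with hr
  set G := metricIn g φ with hGdef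
  have hGd : ∀ z, bd z ∈ chartImage φ → ∀ i j,
      DifferentiableWithinAt ℝ (fun x => G x i j) halfSpace (bd z) := fun z hz i j =>
    (contDiffOn_metricIn g hφ.1 i j).differentiableWithinAt_halfSpace hz
  have hUd : ∀ z, bd z ∈ chartImage φ → ∀ i,
      DifferentiableWithinAt ℝ (fun x => fieldIn φ s.re x i) halfSpace (bd z) := fun z hz i =>
    (contDiffOn_fieldIn hφ.1 s.smooth_re i).differentiableWithinAt_halfSpace hz
  have hUd' : ∀ z, bd z ∈ chartImage φ → ∀ i,
      DifferentiableWithinAt ℝ (fun x => fieldIn φ s.im x i) halfSpace (bd z) := fun z hz i =>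
    (contDiffOn_fieldIn hφ.1 s.smooth_im i).differentiableWithinAt_halfSpace hz
  have hdual : ∀ {u : VField M}, (∀ i, ContDiffOn ℝ ∞ (fun x => fieldIn φ u x i) (chartImage φ)) →
      ∀ j, ContDiffOn ℝ ∞ (fun x => dualIn g φ u x j) (chartImage φ) := fun {u} hu j => by
    simp only [dualIn, lower, Matrix.mulVec, dotProduct]
    exact ContDiffOn.sum fun i _ => (contDiffOn_metricIn g hφ.1 j i).mul (hu i)
  have hτ := hdual (contDiffOn_fieldIn hφ.1 s.smooth_re)
  have hτ' := hdual (contDiffOn_fieldIn hφ.1 s.smooth_im)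
  have hWd : ∀ i k j, HasPd halfSpace i (fun x => endIn φ Ω.re x k j)
      (pd halfSpace i (fun x => endIn φ Ω.re x k j) (bd y)) (bd y) := fun i k j =>
    ((contDiffOn_endIn hφ.1 Ω.smooth_re k j).differentiableWithinAt_halfSpace hy).hasPd i
  have hu3 := uniqueDiffOn_halfSpace (bd y) (bd_mem_halfSpace y)
  have hu2 : UniqueDiffWithinAt ℝ (univ : Set (Coord 2)) y := uniqueDiffWithinAt_univ
  -- on the boundary the normal row and column of the real part of `Ω` are symmetric
  have hskew : ∀ z, bd z ∈ chartImage φ →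
      r ^ 2 * endIn φ Ω.re (bd z) 2 0 - 1 * endIn φ Ω.re (bd z) 0 2 = 0 ∧
      1 * endIn φ Ω.re (bd z) 0 1 - q ^ 2 * endIn φ Ω.re (bd z) 1 0 = 0 := fun z hz => by
    have hw := hwarp z hz
    obtain ⟨e1, e2⟩ := hw.skew_dERe (bd_mem_halfSpace z) (hGd z hz) (hUd z hz) (fieldIn φ s.im)
    have hc := hcurl φ hφ z hz
    have hc1 := congrFun hc 1
    have hc2 := congrFun hc 2
    simp only [Pi.smul_apply, smul_eq_mul] at hc1 hc2
    rw [hc1, sub_self, mul_zero] at e1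
    rw [hc2, sub_self, mul_zero] at e2
    obtain ⟨s01, s10, s02, s20, -⟩ := standardForm_symm (R := R) (a := a) (b := b) (x := bd z)
      (by rw [hb0, add_zero]; exact hR)
    rw [(hs φ hφ _ hz).1, (hstd _ hz).1]
    simp only [Matrix.add_apply, Matrix.map_apply, s01, s10, s02, s20, Complex.zero_re, zero_add]
    constructor
    · linear_combination e1
    · linear_combination e2
  have hskew' : q ^ 2 * endIn φ Ω.im (bd y) 1 2 - r ^ 2 * endIn φ Ω.im (bd y) 2 1 =
      pd univ 1 (fun z => tangPart (dualIn g φ s.im) z 0) y -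
        pd univ 0 (fun z => tangPart (dualIn g φ s.im) z 1) y -
        2 * (q * r) * fieldIn φ s.re (bd y) 0 := by
    have hw := hwarp y hy
    have e := hw.skew_dEIm (bd_mem_halfSpace y) (hGd y hy) (fieldIn φ s.re) (hUd' y hy)
    obtain ⟨-, -, -, -, e'⟩ := standardForm_symm (R := R) (a := a) (b := b) (x := bd y)
      (by rw [hb0, add_zero]; exact hR)
    have e'' := congrArg Complex.im e'
    rw [Complex.im_ofReal_mul, Complex.im_ofReal_mul, hb0, add_zero] at e''
    have p1 : pd univ 1 (fun z => tangPart (dualIn g φ s.im) z 0) y =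
        pd halfSpace 2 (fun x => dualIn g φ s.im x 1) (bd y) :=
      (HasPd.comp_bd (a := 1)
        (((hτ' 1).differentiableWithinAt_halfSpace hy).hasPd 2)).pd_eq hu2
    have p0 : pd univ 0 (fun z => tangPart (dualIn g φ s.im) z 1) y =
        pd halfSpace 1 (fun x => dualIn g φ s.im x 2) (bd y) :=
      (HasPd.comp_bd (a := 0)
        (((hτ' 2).differentiableWithinAt_halfSpace hy).hasPd 1)).pd_eq hu2
    rw [(hs φ hφ _ hy).2, (hstd _ hy).2, p1, p0]
    simp only [Matrix.add_apply, Matrix.map_apply, dualIn]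
    linear_combination e + e''
  -- so their tangential derivatives are symmetric as well
  have t1 : pd halfSpace 1 (fun x => endIn φ Ω.re x 0 1) (bd y) -
      q ^ 2 * pd halfSpace 1 (fun x => endIn φ Ω.re x 1 0) (bd y) = 0 := by
    have h1 := HasPd.comp_bd (a := 0) (((hWd 1 0 1).const_mul 1).sub ((hWd 1 1 0).const_mul (q ^ 2)))
    have h2 : HasPd univ 0 (fun z => 1 * endIn φ Ω.re (bd z) 0 1 -
        q ^ 2 * endIn φ Ω.re (bd z) 1 0) 0 y := by
      refine (hasPd_const 0).congr ?_ (mem_univ _)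
      rw [nhdsWithin_univ]
      filter_upwards [hev] with z hz using (hskew z hz).2
    linear_combination (h1.pd_eq hu2).symm.trans (h2.pd_eq hu2)
  have t2 : r ^ 2 * pd halfSpace 2 (fun x => endIn φ Ω.re x 2 0) (bd y) -
      pd halfSpace 2 (fun x => endIn φ Ω.re x 0 2) (bd y) = 0 := by
    have h1 := HasPd.comp_bd (a := 1) (((hWd 2 2 0).const_mul (r ^ 2)).sub ((hWd 2 0 2).const_mul 1))
    have h2 : HasPd univ 1 (fun z => r ^ 2 * endIn φ Ω.re (bd z) 2 0 -
        1 * endIn φ Ω.re (bd z) 0 2) 0 y := by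
      refine (hasPd_const 0).congr ?_ (mem_univ _)
      rw [nhdsWithin_univ]
      filter_upwards [hev] with z hz using (hskew z hz).1
    linear_combination (h1.pd_eq hu2).symm.trans (h2.pd_eq hu2)
  have hgrad := ((hwarp y hy).grad_trace (fun i j => ((hΩ φ hφ _ hy).1 i j).1)
    (hΩ φ hφ _ hy).2.1 (fun i k j => rfl)).1
  have htr : pd halfSpace 0 (fun x => (endIn φ Ω.re x).trace) (bd y) =
      pd halfSpace 0 (fun x => endIn φ Ω.re x 0 0) (bd y) +
      pd halfSpace 0 (fun x => endIn φ Ω.re x 1 1) (bd y) +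
      pd halfSpace 0 (fun x => endIn φ Ω.re x 2 2) (bd y) := by
    simp only [Matrix.trace, Matrix.diag, Fin.sum_univ_three]
    exact (((hWd 0 0 0).add (hWd 0 1 1)).add (hWd 0 2 2)).pd_eq hu3
  rw [hskew', ← htr] at hgrad
  -- the normal part of `τ`
  have hnorm : ∀ z, bd z ∈ chartImage φ →
      normalPart G (dualIn g φ s.re) z = dualIn g φ s.re (bd z) 0 := fun z hz => by
    rw [normalPart, (hwarp z hz).normal_eq]
    simp
  have hh : normalPart G (dualIn g φ s.re) y = fieldIn φ s.re (bd y) 0 := by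
    rw [hnorm y hy, dualIn, lower, ← hGdef, (hwarp y hy).val, Matrix.mulVec_diagonal]
    simp
  have hhc : ContDiffAt ℝ 2 (normalPart G (dualIn g φ s.re)) y := by
    refine (contDiffAt_comp_bd (n := 2) (hτ 0) hy).congr_of_eventuallyEq ?_
    filter_upwards [hev] with z hz using hnorm z hz
  set F : Coord 2 → ℝ := fun z => deltaS G (tangPart (dualIn g φ s.re)) z -
    2 * normalPart G (dualIn g φ s.re) z with hF
  have hsecond := hflat.curl_of_condition (F := F) (ε := ε)
    (σ := tangPart (dualIn g φ s.re))
    (fun i => contDiffAt_comp_bd (n := 3) (hτ i.succ) hy) hhc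
    (by filter_upwards [hev] with z hz using hbc₂ φ hφ z hz) (fun z => rfl)
  -- by the first boundary condition `f = -2 ε F` on the boundary
  have hfF : ∀ z, bd z ∈ chartImage φ → F z = -(2 * ε)⁻¹ * f z := fun z hz => by
    have h1 := hbc₁ φ hφ z hz
    have h2 := trace_endIn_eq hφ hs hz
    have h3 : (endIn φ Ω'.re (bd z)).trace = 0 := by
      rw [(hstd _ hz).1]
      have := trace_standardForm (R := R) (a := a) (b := b) (x := bd z)
        (by rw [hb0, add_zero]; exact hR)
      have h4 := congrArg Complex.re this
      simpa [Matrix.trace, Fin.sum_univ_three] using h4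
    rw [hf, h2, h3, hF]
    field_simp
    linear_combination -h1
  have hFF : ∀ i, pd univ i (fun z => pd univ i F z) y =
      -(2 * ε)⁻¹ * pd univ i (fun z => pd univ i f z) y := fun i => by
    rw [← pd_const_mul hu2]
    refine pd_congr ?_ (mem_univ _)
    rw [nhdsWithin_univ]
    filter_upwards [hev.eventually_nhds] with z hz
    rw [← pd_const_mul uniqueDiffWithinAt_univ]
    refine pd_congr ?_ (mem_univ _)
    rw [nhdsWithin_univ]
    filter_upwards [hz] with w hw using hfF w hw
  have hFy := hfF y hy
  have hFy' : deltaS G (tangPart (dualIn g φ s.re)) y = F y + 2 * fieldIn φ s.re (bd y) 0 := by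
    rw [hF, ← hh]
    ring
  rw [hFF, hFF, hFy', hFy] at hsecond
  have hgrad' : pd halfSpace 0 (fun x => (endIn φ Ω.re x).trace) (bd y) =
      2 * (q * r)⁻¹ * (pd univ 0 (fun z => tangPart (dualIn g φ s.im) z 1) y -
        pd univ 1 (fun z => tangPart (dualIn g φ s.im) z 0) y) + 4 * fieldIn φ s.re (bd y) 0 := by
    have : q * r * pd halfSpace 0 (fun x => (endIn φ Ω.re x).trace) (bd y) =
      2 * (pd univ 0 (fun z => tangPart (dualIn g φ s.im) z 1) y -
        pd univ 1 (fun z => tangPart (dualIn g φ s.im) z 0) y) +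
        4 * (q * r) * fieldIn φ s.re (bd y) 0 := by
      linear_combination hgrad - r / (1 * q) * t1 + q / (1 * r) * t2
    field_simp
    linear_combination this
  rw [hgrad', hsecond]
  field_simp
  ring

/-- At a boundary point no multiple of the divergence has a positive local maximum. -/
lemma mul_divergence_nonpos_of_isLocalMaxOn (hφ : IsPositiveChart o φ) {R : ℝ}
    (hT : IsTubeChart g φ R) {a b : ℂ}
    (hstd : ∀ x ∈ chartImage φ, endIn φ Ω'.re x = (standardForm R a b x).map Complex.re ∧
      endIn φ Ω'.im x = (standardForm R a b x).map Complex.im)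
    (hΩ : IsHarmonic g o Ω) (hs : EqAddCoboundary g o Ω Ω' s) {ε : ℝ} (hε : 0 < ε)
    (hcurl : IsHalfCurlOnBoundary g o s.re s.im) (hbc₁ : BoundaryCondition₁ g o ε s.re)
    (hbc₂ : BoundaryCondition₂ g o ε s.re s.im) {y : Coord 2} (hy : bd y ∈ chartImage φ) {c : ℝ}
    (hmax : IsLocalMaxOn (fun z => c * (endIn φ Ω.re z).trace) halfSpace (bd y)) :
    c * (endIn φ Ω.re (bd y)).trace ≤ 0 := by
  have hcone : (EuclideanSpace.single 0 1 : Coord 3) ∈ posTangentConeAt halfSpace (bd y) := by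
    refine mem_posTangentConeAt_of_segment_subset ?_
    rw [← range_model_eq_halfSpace]
    refine (𝓡∂ 3).convex_range.segment_subset ?_ ?_ <;> rw [range_model_eq_halfSpace]
    · exact bd_mem_halfSpace y
    · simp [halfSpace, bd]
  have h1 : c * pd halfSpace 0 (fun x => (endIn φ Ω.re x).trace) (bd y) ≤ 0 := by
    rw [← pd_const_mul (uniqueDiffOn_halfSpace _ (bd_mem_halfSpace y))]
    exact hmax.fderivWithin_nonpos hcone
  set f : Coord 2 → ℝ := fun z => (endIn φ Ω.re (bd z)).trace with hf
  have hmax2 : IsLocalMax (fun z => c * f z) y := (tendsto_bd y).eventually hmax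
  have hfc : ContDiffAt ℝ 2 f y := contDiffAt_comp_bd (n := 2) (contDiffOn_trace_endIn hφ.1 Ω) hy
  have h2 : ∀ i, c * pd univ i (fun z => pd univ i f z) y ≤ 0 := fun i => by
    have := hmax2.pd_pd_nonpos (contDiffAt_const.mul hfc) i
    simpa only [pd_const_mul uniqueDiffWithinAt_univ] using this
  rw [normal_deriv_trace hφ hT hstd hΩ hs hε hcurl hbc₁ hbc₂ hy (fun z => rfl)] at h1
  have hq : 0 < Real.sinh R := Real.sinh_pos_iff.2 hT.1
  have hr : 0 < Real.cosh R := Real.cosh_pos R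
  have h3 := mul_nonpos_of_nonneg_of_nonpos (by positivity :
    0 ≤ Real.cosh R / Real.sinh R / Real.sinh R ^ 2) (h2 0)
  have h4 := mul_nonpos_of_nonneg_of_nonpos (by positivity :
    0 ≤ Real.sinh R / Real.cosh R / Real.cosh R ^ 2) (h2 1)
  have h5 : c * f y / ε ≤ 0 := by
    have e : c * f y / ε = c * (f y / ε) := by ring
    rw [e]
    linarith
  by_contra hcon
  push Not at hcon
  exact absurd (div_pos hcon hε) (not_lt.2 h5)

end Deformation

/-! ### Vanishing of the divergence -/

section Conclusion

variable {M : Type*} [TopologicalSpace M] [ChartedSpace (EuclideanHalfSpace 3) M]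
  [IsManifold (𝓡∂ 3) ∞ M] {g : RMetric M}
  {o : ∀ p : M, Orientation ℝ (TangentSpace (𝓡∂ 3) p) (Fin 3)}
  {Ω Ω' : EOneForm M} {s : ESection M}

/-- No multiple of the divergence has a positive maximum. -/
lemma mul_divergence_nonpos (hM : IsHyperbolicTubular g o)
    (hΩ : IsHarmonic g o Ω) (hΩ' : IsStandardNearBoundary g o Ω') (hs : EqAddCoboundary g o Ω Ω' s)
    {ε : ℝ} (hε : 0 < ε) (hcurl : IsHalfCurlOnBoundary g o s.re s.im)
    (hbc₁ : BoundaryCondition₁ g o ε s.re) (hbc₂ : BoundaryCondition₂ g o ε s.re s.im)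
    {c : ℝ} (hc : c ≠ 0) {p : M} (hp : ∀ p', c * divergence Ω p' ≤ c * divergence Ω p) :
    c * divergence Ω p ≤ 0 := by
  have hmax : ∀ {φ : Chart M}, IsPositiveChart o φ → p ∈ φ.source →
      IsLocalMaxOn (fun z => c * (endIn φ Ω.re z).trace) halfSpace (φ.extend (𝓡∂ 3) p) := by
    intro φ hφ hpφ
    have hx := extend_mem_chartImage φ hpφ
    filter_upwards [chartImage_mem_nhdsWithin φ hx] with z hz
    rw [← divergence_pt hφ hz, ← divergence_pt hφ hx, pt_extend φ hpφ]
    exact hp _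
  have hmax' : ∀ {φ : Chart M}, IsPositiveChart o φ → p ∈ φ.source →
      0 < φ.extend (𝓡∂ 3) p 0 →
      IsLocalMax (fun z => c * (endIn φ Ω.re z).trace) (φ.extend (𝓡∂ 3) p) := by
    intro φ hφ hpφ h0
    refine (hmax hφ hpφ).isLocalMax ?_
    exact Filter.mem_of_superset ((isOpen_lt continuous_const
      (EuclideanSpace.proj (0 : Fin 3) : Coord 3 →L[ℝ] ℝ).continuous).mem_nhds h0)
      fun z hz => le_of_lt (show 0 < z 0 from hz)
  have hdiv : ∀ {φ : Chart M}, IsPositiveChart o φ → p ∈ φ.source →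
      divergence Ω p = (endIn φ Ω.re (φ.extend (𝓡∂ 3) p)).trace := by
    intro φ hφ hpφ
    have := divergence_pt hφ (extend_mem_chartImage φ hpφ) Ω
    rwa [pt_extend φ hpφ] at this
  have hcases : p ∈ (𝓡∂ 3).interior M ∪ (𝓡∂ 3).boundary M := by
    rw [ModelWithCorners.interior_union_boundary_eq_univ]
    exact mem_univ p
  rcases hcases with h | h
  · obtain ⟨φ, hφ, hpφ, hG⟩ := hM.interior p h
    have hx := extend_mem_chartImage φ hpφ
    have h0 := (hG _ hx).1
    have hinv : ContDiffAt ℝ 2 (fun t : ℝ => t⁻¹) (φ.extend (𝓡∂ 3) p 0) :=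
      contDiffAt_inv ℝ h0.ne'
    rw [hdiv hφ hpφ]
    refine mul_divergence_nonpos_of_isLocalMax hφ hΩ (p := fun t => t⁻¹) (q := fun t => t⁻¹)
      (r := fun t => t⁻¹) (fun x hx => ?_) hx h0 hinv hinv hinv (inv_pos.2 h0) (inv_pos.2 h0)
      (inv_pos.2 h0) hc (hmax' hφ hpφ h0)
    rw [(hG x hx).2, upperHalfMetric, warpMetric, Matrix.smul_one_eq_diagonal]
    congr 1
    ext i
    fin_cases i <;> simp
  · obtain ⟨φ, R, a, b, hφ, hpφ, hT, hstd⟩ := hΩ' p h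
    have hx := extend_mem_chartImage φ hpφ
    have hR := hT.1
    rw [hdiv hφ hpφ]
    rcases (show 0 ≤ φ.extend (𝓡∂ 3) p 0 from chartImage_subset φ hx).lt_or_eq with h0 | h0
    · exact mul_divergence_nonpos_of_isLocalMax hφ hΩ (p := fun _ => 1)
        (q := fun t => Real.sinh (R + t)) (r := fun t => Real.cosh (R + t))
        (fun x hx => by rw [hT.2 x hx, tubeMetric_eq_warpMetric]) hx h0 contDiffAt_const
        (Real.contDiff_sinh.comp (contDiff_const.add contDiff_id)).contDiffAt
        (Real.contDiff_cosh.comp (contDiff_const.add contDiff_id)).contDiffAt one_pos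
        (Real.sinh_pos_iff.2 (by linarith)) (Real.cosh_pos _) hc (hmax' hφ hpφ h0)
    · set y : Coord 2 := !₂[φ.extend (𝓡∂ 3) p 1, φ.extend (𝓡∂ 3) p 2] with hy
      have hbd : bd y = φ.extend (𝓡∂ 3) p := bd_of_coord_zero h0.symm
      have hm := hmax hφ hpφ
      rw [← hbd] at hx hm ⊢
      exact mul_divergence_nonpos_of_isLocalMaxOn hφ hT hstd hΩ hs hε hcurl hbc₁ hbc₂ hx hm

lemma divergence_eq_zero [CompactSpace M] (hM : IsHyperbolicTubular g o)
    (hΩ : IsHarmonic g o Ω) (hΩ' : IsStandardNearBoundary g o Ω') (hs : EqAddCoboundary g o Ω Ω' s)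
    {ε : ℝ} (hε : 0 < ε) (hcurl : IsHalfCurlOnBoundary g o s.re s.im)
    (hbc₁ : BoundaryCondition₁ g o ε s.re) (hbc₂ : BoundaryCondition₂ g o ε s.re s.im) (p : M) :
    divergence Ω p = 0 := by
  have key : ∀ c : ℝ, c ≠ 0 → c * divergence Ω p ≤ 0 := fun c hc => by
    obtain ⟨p₀, -, hp₀⟩ := isCompact_univ.exists_isMaxOn ⟨p, mem_univ p⟩
      ((continuous_divergence hM Ω).const_mul c).continuousOn
    exact (hp₀ (mem_univ p)).trans (mul_divergence_nonpos hM hΩ hΩ' hs hε hcurl hbc₁ hbc₂ hc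
      fun p' => hp₀ (mem_univ p'))
  have h1 := key 1 one_ne_zero
  have h2 := key (-1) (by norm_num)
  linarith

/-- At the boundary the divergence of a standard form vanishes, so that of `Ω` is minus the
codifferential of the dual of the infinitesimal translation. -/
lemma codiff_eq_neg_divergence (hΩ' : IsStandardNearBoundary g o Ω')
    (hs : EqAddCoboundary g o Ω Ω' s) {φ : Chart M} (hφ : IsPositiveChart o φ) {y : Coord 2}
    (hy : bd y ∈ chartImage φ) :
    codiff halfSpace (metricIn g φ) (dualIn g φ s.re) (bd y) = -divergence Ω (pt φ (bd y)) := by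
  obtain ⟨ψ, R, a, b, hψ, hpψ, hT, hstd⟩ := hΩ' _ (pt_bd_mem_boundary hφ.1 hy)
  have hx := extend_mem_chartImage ψ hpψ
  have hx0 : 0 ≤ ψ.extend (𝓡∂ 3) (pt φ (bd y)) 0 := chartImage_subset ψ hx
  have h0 : divergence Ω' (pt φ (bd y)) = 0 := by
    have h1 := divergence_pt hψ hx Ω'
    rw [pt_extend ψ hpψ, (hstd _ hx).1] at h1
    rw [h1]
    have h2 := congrArg Complex.re (trace_standardForm (R := R) (a := a) (b := b)
      (x := ψ.extend (𝓡∂ 3) (pt φ (bd y))) (by linarith [hT.1]))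
    simpa [Matrix.trace, Fin.sum_univ_three] using h2
  rw [divergence_pt hφ hy, trace_endIn_eq hφ hs hy, ← divergence_pt hφ hy, h0]
  ring

end Conclusion

end HarmonicDeformation

open HarmonicDeformation in
theorem mainTheorem7 {M : Type*} [TopologicalSpace M] [T2Space M] [CompactSpace M]
    [ChartedSpace (EuclideanHalfSpace 3) M] [IsManifold (𝓡∂ 3) ∞ M]
    (g : HarmonicDeformation.RMetric M)
    (o : ∀ p : M, Orientation ℝ (TangentSpace (𝓡∂ 3) p) (Fin 3))
    (hM : IsHyperbolicTubular g o)
    (Ω Ω' : EOneForm M) (s : ESection M)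
    (hΩ : IsHarmonic g o Ω)
    (hΩ' : IsStandardNearBoundary g o Ω')
    (hs : EqAddCoboundary g o Ω Ω' s)
    (ε : ℝ) (hε : 0 < ε)
    (hcurl : IsHalfCurlOnBoundary g o s.re s.im)
    (hbc₁ : BoundaryCondition₁ g o ε s.re)
    (hbc₂ : BoundaryCondition₂ g o ε s.re s.im) :
    (∀ p : M, divergence Ω p = 0) ∧
    ∀ φ : Chart M, IsPositiveChart o φ → ∀ y : Coord 2, bd y ∈ chartImage φ →
      2 * normalPart (metricIn g φ) (dualIn g φ s.re) y =
        deltaS (metricIn g φ) (tangPart (dualIn g φ s.re)) y ∧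
      (2 : ℝ) • tangPart (dualIn g φ s.im) y =
        hodgeStar (metricIn g φ) (fun z =>
          (2 : ℝ) • shapeForm (metricIn g φ) (tangPart (dualIn g φ s.re)) z
          + ε • deltaD (metricIn g φ) (tangPart (dualIn g φ s.re)) z) y := by
  have hdiv := divergence_eq_zero hM hΩ hΩ' hs hε hcurl hbc₁ hbc₂
  refine ⟨hdiv, fun φ hφ y hy => ?_⟩
  have hF : ∀ z, bd z ∈ chartImage φ → deltaS (metricIn g φ) (tangPart (dualIn g φ s.re)) z =
      2 * normalPart (metricIn g φ) (dualIn g φ s.re) z := fun z hz => by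
    have h1 := hbc₁ φ hφ z hz
    have h2 := codiff_eq_neg_divergence hΩ' hs hφ hz
    rw [hdiv, neg_zero] at h2
    simp only [h2, zero_sub, neg_eq_zero, mul_eq_zero, hε.ne', or_false, OfNat.ofNat_ne_zero,
      false_or] at h1
    linarith
  refine ⟨(hF y hy).symm, ?_⟩
  -- `δ_S σ = 2 h` on a neighbourhood of `y` in the boundary, so `d_S (δ_S σ - 2 h)` vanishes at `y`
  have hgrad : grad univ (deltaS (metricIn g φ) (tangPart (dualIn g φ s.re))) y =
      (2 : ℝ) • grad univ (normalPart (metricIn g φ) (dualIn g φ s.re)) y := by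
    ext i
    simp only [grad, Pi.smul_apply, smul_eq_mul]
    rw [← pd_const_mul uniqueDiffWithinAt_univ]
    refine pd_congr ?_ (mem_univ _)
    rw [nhdsWithin_univ]
    filter_upwards [eventually_bd_mem hy] with z hz using hF z hz
  have hS : dS (metricIn g φ) (deltaS (metricIn g φ) (tangPart (dualIn g φ s.re))) y =
      (2 : ℝ) • dS (metricIn g φ) (normalPart (metricIn g φ) (dualIn g φ s.re)) y := by
    rw [dS, shapeForm, hgrad, Matrix.smul_vecMul, dS, shapeForm]
  have h := sub_eq_zero.1 (hbc₂ φ hφ y hy)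
  rw [h]
  simp only [hodgeStar, laplaceS, hS, add_sub_cancel_right]
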